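/- **Setting.** Let $Q=[0,1]^2$, with the max norm on $\mathbb R^2$. Let $\{E_i\}$ be a countable family of closed full height curvilinear rectangles $E_i=\{(x,y): 0\le y\le 1,\ l_i(y)\le x\le r_i(y)\}$, where $l_i,r_i$ are continuous and $0\le l_i<r_i\le 1$. For each $i$ let $f_i$ be a $C^2$ diffeomorphism, defined on an open neighbourhood of $E_i$, that maps $E_i$ onto a full width strip $S_i=\{(x,y): 0\le x\le 1,\ b_i(x)\le y\le t_i(x)\}$, where $b_i,t_i$ are continuous and $0\le b_i<t_i\le 1$; it maps the left and right sides of $E_i$ into the vertical lines $\{x=0\}\cup\{x=1\}$ and the top and bottom of $E_i$ into the graphs of $b_i$ and $t_i$. Write $F=f_i=(F_1,F_2)$ on $E_i$, let $F_{jx},F_{jy}$ be the partial derivatives and $J_F=|F_{1x}F_{2y}-F_{1y}F_{2x}|$. Let $|f_{ix}|$ be the max norm of the vector $f_{ix}=\partial f_i/\partial x$, and $|D^2f_i|$ the largest absolute value of the second partial derivatives of the two components of $f_i$. Let $\delta_{i,\max}$ and $\delta_{i,\min}$ be the largest and the smallest length of a horizontal section $E_i\cap\{y=\text{const}\}$,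 $0\le \text{const}\le1$. Let $0<\alpha<1$, $K_0>1$, $C_0>0$, and assume: * (G) the interiors of the $E_i$ are pairwise disjoint, and so are those of the $S_i$; $Q\setminus\bigcup_i \operatorname{int}E_i$ has Lebesgue measure $0$; $-\sum_i\delta_{i,\max}\log\delta_{i,\min}<\infty$; * (H) at every point of every $E_i$, $|F_{2x}|+\alpha|F_{2y}|+\alpha^2|F_{1y}|\le\alpha|F_{1x}|$, $|F_{1x}|-\alpha|F_{1y}|\ge K_0$, $|F_{1y}|+\alpha|F_{2y}|+\alpha^2|F_{2x}|\le\alpha|F_{1x}|$, $|F_{1x}|-\alpha|F_{2x}|\ge J_FK_0$; moreover $\frac1{K_0^2}+\alpha^2<1$; * (D) $|D^2f_i(z)|/|f_{ix}(z)|\le C_0$ for all $i$ and all $z\in E_i$. For finite words put $E_{i_0\dots i_{n-1}}=E_{i_0}\cap f_{i_0}^{-1}(E_{i_1\dots i_{n-1}})$ and $S_{i_{-m}\dots i_{-1}}=f_{i_{-1}}(S_{i_{-m}\dots i_{-2}}\cap E_{i_{-1}})$, with $Q$ for the empty word, and $R_{i_{-m}\dots i_{-1},i_0\dots i_{n-1}}=S_{i_{-m}\dots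 i_{-1}}\cap E_{i_0\dots i_{n-1}}$. The unstable manifold of a past $(\dots,i_{-2},i_{-1})$ is $\bigcap_{k\ge1}S_{i_{-k}\dots i_{-1}}$, and the stable manifold of a future $(i_0,i_1,\dots)$ is $\bigcap_{k\ge1}E_{i_0\dots i_{k-1}}$. **Lemma 5.2.** There are constants $c_0>0$ and $0<\theta_0<1$, depending only on $\alpha,K_0,C_0$, such that the following holds for every such system. Let $m\ge0$, $n\ge1$, and let $R=R_{i_{-m}\dots i_{-1},i_0\dots i_{n-1}}$. Let $W_3^u$ and $W_4^u$ be the unstable manifolds of two pasts that both end with $i_{-m}\dots i_{-1}$, and let $W^s$ be the stable manifold of a future that begins with $i_0\dots i_{n-1}$. Let $Z_3\in R\cap W_3^u\cap W^s$ and $Z_4\in R\cap W_4^u\cap W^s$. Then $W_3^u$ and $W_4^u$ are graphs of functions $y=g(x)$, $0\le x\le1$, that have a derivative (one-sided if $x\in\{0,1\}$) at $Z_3$ and $Z_4$ respectively, and the slopes $a_{Z_3}=dy/dx$ of $W_3^u$ at $Z_3$ and $a_{Z_4}=dy/dx$ of $W_4^u$ at $Z_4$ satisfy $$|a_{Z_3}-a_{Z_4}|<c_0\theta_0^m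 .$$ -/

import Mathlib

open Set MeasureTheory

noncomputable section

namespace CountableMarkov

/-- The unit square `Q`.  The norm of `ℝ × ℝ` is the max norm. -/
def Q : Set (ℝ × ℝ) := Icc 0 1 ×ˢ Icc 0 1

/-- The curvilinear rectangle of full height with left and right sides
`x = l y` and `x = r y`. -/
def fullHeight (l r : ℝ → ℝ) : Set (ℝ × ℝ) :=
  {z | z.2 ∈ Icc (0 : ℝ) 1 ∧ z.1 ∈ Icc (l z.2) (r z.2)}

/-- The strip of full width with lower and upper boundaries `y = b x` and `y = t x`. -/
def fullWidth (b t : ℝ → ℝ) : Set (ℝ × ℝ) :=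
  {z | z.1 ∈ Icc (0 : ℝ) 1 ∧ z.2 ∈ Icc (b z.1) (t z.1)}

/-- The partial derivative `∂F/∂x`, with components `(F_{1x}, F_{2x})`. -/
def dx (F : ℝ × ℝ → ℝ × ℝ) (z : ℝ × ℝ) : ℝ × ℝ := fderiv ℝ F z (1, 0)

/-- The partial derivative `∂F/∂y`, with components `(F_{1y}, F_{2y})`. -/
def dy (F : ℝ × ℝ → ℝ × ℝ) (z : ℝ × ℝ) : ℝ × ℝ := fderiv ℝ F z (0, 1)

/-- The absolute value of the Jacobian determinant. -/
def jac (F : ℝ × ℝ → ℝ × ℝ) (z : ℝ × ℝ) : ℝ :=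
  |(dx F z).1 * (dy F z).2 - (dy F z).1 * (dx F z).2|

/-- The largest absolute value of the second partial derivatives of the two components. -/
def secondDerivSize (F : ℝ × ℝ → ℝ × ℝ) (z : ℝ × ℝ) : ℝ :=
  max ‖dx (dx F) z‖ (max ‖dx (dy F) z‖ ‖dy (dy F) z‖)

/-- The width of `A` along the horizontal line through `z`. -/
def width (A : Set (ℝ × ℝ)) (z : ℝ × ℝ) : ℝ := Metric.diam {w ∈ A | w.2 = z.2}

/-- A family of full height curvilinear rectangles `E i` in the unit square, with
`C²` diffeomorphisms `f i`, each defined near `E i` and mapping it onto a full width strip `S i`,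
so that the left and right sides go to the left and right sides and the top and bottom to the top
and bottom (in either order). -/
structure MarkovSystem (ι : Type*) where
  left : ι → ℝ → ℝ
  right : ι → ℝ → ℝ
  bottom : ι → ℝ → ℝ
  top : ι → ℝ → ℝ
  f : ι → OpenPartialHomeomorph (ℝ × ℝ) (ℝ × ℝ)
  left_cont : ∀ i, ContinuousOn (left i) (Icc 0 1)
  right_cont : ∀ i, ContinuousOn (right i) (Icc 0 1)
  bottom_cont : ∀ i, ContinuousOn (bottom i) (Icc 0 1)
  top_cont : ∀ i, ContinuousOn (top i) (Icc 0 1)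
  left_right : ∀ i, ∀ y ∈ Icc (0 : ℝ) 1, 0 ≤ left i y ∧ left i y < right i y ∧ right i y ≤ 1
  bottom_top : ∀ i, ∀ x ∈ Icc (0 : ℝ) 1, 0 ≤ bottom i x ∧ bottom i x < top i x ∧ top i x ≤ 1
  subset_source : ∀ i, fullHeight (left i) (right i) ⊆ (f i).source
  contDiffOn : ∀ i, ContDiffOn ℝ 2 (f i) (f i).source
  contDiffOn_symm : ∀ i, ContDiffOn ℝ 2 (f i).symm (f i).target
  image_eq : ∀ i, f i '' fullHeight (left i) (right i) = fullWidth (bottom i) (top i)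
  map_sides : ∀ i, ∀ z ∈ fullHeight (left i) (right i),
    z.1 = left i z.2 ∨ z.1 = right i z.2 → (f i z).1 = 0 ∨ (f i z).1 = 1
  map_top_bottom : ∀ i, ∀ z ∈ fullHeight (left i) (right i),
    z.2 = 0 ∨ z.2 = 1 → (f i z).2 = bottom i (f i z).1 ∨ (f i z).2 = top i (f i z).1

namespace MarkovSystem

variable {ι : Type*} (M : MarkovSystem ι)

def E (i : ι) : Set (ℝ × ℝ) := fullHeight (M.left i) (M.right i)

def S (i : ι) : Set (ℝ × ℝ) := fullWidth (M.bottom i) (M.top i)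

/-- The geometric conditions: disjoint interiors, full measure, and summability of
`-δ_{i,max} log δ_{i,min}`. -/
structure Geometric : Prop where
  disjoint_E : ∀ i j, i ≠ j → Disjoint (interior (M.E i)) (interior (M.E j))
  disjoint_S : ∀ i j, i ≠ j → Disjoint (interior (M.S i)) (interior (M.S j))
  full_measure : volume (Q \ ⋃ i, interior (M.E i)) = 0
  summable_width : Summable fun i =>
    -(sSup (width (M.E i) '' Q) * Real.log (sInf (width (M.E i) '' Q)))

/-- The hyperbolicity conditions with constants `α` and `K₀`. -/
structure Hyperbolic (α K₀ : ℝ) : Prop where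
  h1 : ∀ i, ∀ z ∈ M.E i,
    |(dx (M.f i) z).2| + α * |(dy (M.f i) z).2| + α ^ 2 * |(dy (M.f i) z).1|
      ≤ α * |(dx (M.f i) z).1|
  h2 : ∀ i, ∀ z ∈ M.E i, K₀ ≤ |(dx (M.f i) z).1| - α * |(dy (M.f i) z).1|
  h3 : ∀ i, ∀ z ∈ M.E i,
    |(dy (M.f i) z).1| + α * |(dy (M.f i) z).2| + α ^ 2 * |(dx (M.f i) z).2|
      ≤ α * |(dx (M.f i) z).1|
  h4 : ∀ i, ∀ z ∈ M.E i,
    jac (M.f i) z * K₀ ≤ |(dx (M.f i) z).1| - α * |(dx (M.f i) z).2|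
  h5 : 1 / K₀ ^ 2 + α ^ 2 < 1

/-- The distortion condition `|D² f_i(z)| / |f_{ix}(z)| ≤ C₀` on all the `E i`. -/
def Distortion (C₀ : ℝ) : Prop :=
  ∀ i, ∀ z ∈ M.E i, secondDerivSize (M.f i) z / ‖dx (M.f i) z‖ ≤ C₀

/-- The strip `S_{i_{-m} … i_{-1}}`, where `p k` is the symbol `i_{-(k+1)}`;
without symbols it is `Q`. -/
def strip : (ℕ → ι) → ℕ → Set (ℝ × ℝ)
  | _, 0 => Q
  | p, m + 1 => M.f (p 0) '' (strip (fun k => p (k + 1)) m ∩ M.E (p 0))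

/-- The full height rectangle `E_{i_0 … i_{n-1}}`, where `q k` is the symbol `i_k`;
without symbols it is `Q`. -/
def cylinder : (ℕ → ι) → ℕ → Set (ℝ × ℝ)
  | _, 0 => Q
  | q, n + 1 => M.E (q 0) ∩ M.f (q 0) ⁻¹' cylinder (fun k => q (k + 1)) n

/-- The rectangle `R_{i_{-m} … i_{-1}, i_0 … i_{n-1}}`. -/
def rect (p q : ℕ → ι) (m n : ℕ) : Set (ℝ × ℝ) := M.strip p m ∩ M.cylinder q n

/-- The unstable manifold of the past `… i_{-2} i_{-1}`. -/
def unstable (p : ℕ → ι) : Set (ℝ × ℝ) := ⋂ m, M.strip p m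

/-- The stable manifold of the future `i_0 i_1 …`. -/
def stable (q : ℕ → ι) : Set (ℝ × ℝ) := ⋂ n, M.cylinder q n

end MarkovSystem

/-- `W` is a curve `y = g x` over `[0, 1]` that passes through `Z`, and `a = g'(Z.1)`
(one-sided at the ends): the tangent vector of `W` at `Z` is `(1, a)`. -/
def IsSlope (W : Set (ℝ × ℝ)) (Z : ℝ × ℝ) (a : ℝ) : Prop :=
  Z ∈ W ∧ ∃ g : ℝ → ℝ, W = {z | z.1 ∈ Icc (0 : ℝ) 1 ∧ z.2 = g z.1} ∧
    HasDerivWithinAt g a (Icc 0 1) Z.1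

/-- A slope is unique. -/
theorem IsSlope.unique {W : Set (ℝ × ℝ)} {Z : ℝ × ℝ} {a b : ℝ}
    (ha : IsSlope W Z a) (hb : IsSlope W Z b) : a = b := by
  obtain ⟨hZ, g, hg, hga⟩ := ha
  obtain ⟨-, h, hh, hhb⟩ := hb
  have hx : Z.1 ∈ Icc (0 : ℝ) 1 := by rw [hg] at hZ; exact hZ.1
  have key : ∀ x ∈ Icc (0 : ℝ) 1, h x = g x := by
    intro x hx
    have h1 : ((x, g x) : ℝ × ℝ) ∈ W := by rw [hg]; exact ⟨hx, rfl⟩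
    rw [hh] at h1
    exact h1.2.symm
  have hga' := hga.congr key (key _ hx)
  exact (uniqueDiffOn_Icc_zero_one _ hx).eq_deriv _ hga' hhb

namespace MarkovSystem

variable {ι : Type*} (M : MarkovSystem ι)

/-- A strip depends only on its finite word. -/
theorem strip_congr (m : ℕ) (p p' : ℕ → ι) (h : ∀ k < m, p k = p' k) :
    M.strip p m = M.strip p' m := by
  induction m generalizing p p' with
  | zero => rfl
  | succ m ih =>
    simp only [strip]
    rw [h 0 (by omega), ih _ _ fun k hk => h (k + 1) (by omega)]

/-- The intersection points of the two manifolds lie in all the rectangles. -/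
theorem mem_rect {p q : ℕ → ι} {Z : ℝ × ℝ} (hu : Z ∈ M.unstable p) (hs : Z ∈ M.stable q)
    (m n : ℕ) : Z ∈ M.rect p q m n :=
  ⟨mem_iInter.1 hu m, mem_iInter.1 hs n⟩

end MarkovSystem

end CountableMarkov

end

noncomputable section

/-! ### Cone estimates and the geometry of a single map -/

namespace CountableMarkov

/-! The derivative of `F = f i` acts on slopes by `a ↦ (F₂ₓ + a F₂ᵧ) / (F₁ₓ + a F₁ᵧ)` (`slopeMap`).
On `|a| ≤ α` this contracts with rate `κ = 1 / (K₀² (1 - α²))` (`slopeMap_contract`), and `h5` says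
exactly that `κ < 1`. For fixed `a` the distortion bound makes it Lipschitz in the base point along
stable manifolds, with constant `C = 8 C₀ / (1 - α²)` (`slopeMap_lipschitz`).

Pull `Z₃` and `Z₄` back along their common past of length `m`. The preimages still lie on one stable
manifold, and each forward step contracts vertical distances there by `1 / K₀` (`vertical_pair`).
Counting steps from the far past, the distances are at most `θ ^ k`, and the slope differences
satisfy `s (k + 1) ≤ κ s k + C θ ^ k`. With `max κ K₀⁻¹ < θ < 1` this gives `s m ≤ c θ ^ m` as soon
as `c ≥ 2` and `c (θ - κ) ≥ C` (`slopes_close`).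

The slopes must first be shown to exist. Near each of its points an unstable manifold lies in a cone
of radius `α` about slope `0`; one application of `F` shrinks the radius of such a cone by `θ`
(`approxSlope_map`), so pulling back `n` steps and returning gives radius `α θ ^ n`, and the
approximate slopes converge (`exists_slope`).

Statements about strips and unstable manifolds come from those about cylinders and stable manifolds:
the inverse maps with exchanged coordinates form a system with the same constants
(`dual_hyperbolic`). -/

theorem fderiv_apply_eq (F : ℝ × ℝ → ℝ × ℝ) (z : ℝ × ℝ) (v : ℝ × ℝ) :
    fderiv ℝ F z v = v.1 • dx F z + v.2 • dy F z := by
  have : v = v.1 • ((1, 0) : ℝ × ℝ) + v.2 • ((0, 1) : ℝ × ℝ) := by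
    ext <;> simp
  conv_lhs => rw [this]
  rw [map_add, map_smul, map_smul]
  rfl

/-- A map whose derivative preserves and expands a horizontal cone along a segment maps the
endpoints to points of the cone, and expands. -/
theorem cone_image_of_segment {F : ℝ × ℝ → ℝ × ℝ} {α K : ℝ} {z z' : ℝ × ℝ}
    (hd : ∀ t ∈ Icc (0 : ℝ) 1, DifferentiableAt ℝ F (z + t • (z' - z)))
    (hcone : |z'.2 - z.2| ≤ α * |z'.1 - z.1|)
    (h1 : ∀ t ∈ Icc (0 : ℝ) 1, ∀ v : ℝ × ℝ, |v.2| ≤ α * |v.1| →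
      |(fderiv ℝ F (z + t • (z' - z)) v).2| ≤ α * |(fderiv ℝ F (z + t • (z' - z)) v).1|)
    (h2 : ∀ t ∈ Icc (0 : ℝ) 1, ∀ v : ℝ × ℝ, |v.2| ≤ α * |v.1| →
      K * |v.1| ≤ |(fderiv ℝ F (z + t • (z' - z)) v).1|) (hK : 0 < K) :
    |(F z').2 - (F z).2| ≤ α * |(F z').1 - (F z).1| ∧
      K * |z'.1 - z.1| ≤ |(F z').1 - (F z).1| := by
  set v := z' - z with hv
  have hcv : |v.2| ≤ α * |v.1| := hcone
  have hγ : ∀ t : ℝ, HasDerivAt (fun t : ℝ => z + t • v) v t := fun t => by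
    simpa using ((hasDerivAt_id t).smul_const v).const_add z
  have hF : ∀ t ∈ Icc (0 : ℝ) 1,
      HasDerivAt (fun t : ℝ => F (z + t • v)) (fderiv ℝ F (z + t • v) v) t := fun t ht =>
    (hd t ht).hasFDerivAt.comp_hasDerivAt t (hγ t)
  have hF1 : ∀ t ∈ Icc (0 : ℝ) 1,
      HasDerivAt (fun t : ℝ => (F (z + t • v)).1) (fderiv ℝ F (z + t • v) v).1 t := fun t ht =>
    (ContinuousLinearMap.fst ℝ ℝ ℝ).hasFDerivAt.comp_hasDerivAt t (hF t ht)
  have hF2 : ∀ t ∈ Icc (0 : ℝ) 1,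
      HasDerivAt (fun t : ℝ => (F (z + t • v)).2) (fderiv ℝ F (z + t • v) v).2 t := fun t ht =>
    (ContinuousLinearMap.snd ℝ ℝ ℝ).hasFDerivAt.comp_hasDerivAt t (hF t ht)
  have e0 : z + (0 : ℝ) • v = z := by simp
  have e1 : z + (1 : ℝ) • v = z' := by simp [hv]
  constructor
  -- Cauchy's mean value theorem treats both components at one common parameter `c`, so the cone
  -- condition on the derivative passes to the chord.
  · obtain ⟨c, hc, h⟩ := exists_ratio_hasDerivAt_eq_ratio_slope
      (fun t : ℝ => (F (z + t • v)).1) (fun t => (fderiv ℝ F (z + t • v) v).1) zero_lt_one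
      (fun t ht => (hF1 t ht).continuousAt.continuousWithinAt)
      (fun t ht => hF1 t (Ioo_subset_Icc_self ht))
      (fun t : ℝ => (F (z + t • v)).2) (fun t => (fderiv ℝ F (z + t • v) v).2)
      (fun t ht => (hF2 t ht).continuousAt.continuousWithinAt)
      (fun t ht => hF2 t (Ioo_subset_Icc_self ht))
    simp only [e0, e1] at h
    have hc' := Ioo_subset_Icc_self hc
    have k1 := h1 c hc' v hcv
    have k2 := h2 c hc' v hcv
    rcases eq_or_ne v.1 0 with h0 | h0
    · have : v.2 = 0 := by
        rw [h0] at hcv; simpa using hcv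
      have hvz : v = 0 := Prod.ext h0 this
      have : z' = z := sub_eq_zero.1 hvz
      simp [this]
    · have hpos : 0 < |(fderiv ℝ F (z + c • v) v).1| :=
        lt_of_lt_of_le (mul_pos hK (abs_pos.2 h0)) k2
      have h' := congrArg abs h
      rw [abs_mul, abs_mul] at h'
      refine le_of_mul_le_mul_right ?_ hpos
      rw [h']
      calc _ ≤ |(F z').1 - (F z).1| * (α * |(fderiv ℝ F (z + c • v) v).1|) := by gcongr
        _ = _ := by ring
  · obtain ⟨c, hc, h⟩ := exists_hasDerivAt_eq_slope
      (fun t : ℝ => (F (z + t • v)).1) (fun t => (fderiv ℝ F (z + t • v) v).1) zero_lt_one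
      (fun t ht => (hF1 t ht).continuousAt.continuousWithinAt)
      (fun t ht => hF1 t (Ioo_subset_Icc_self ht))
    simp only [e0, e1, sub_zero, div_one] at h
    rw [← h]
    exact h2 c (Ioo_subset_Icc_self hc) v hcv

/-- A continuous function with values among those of two strictly ordered continuous functions
is one of them. -/
theorem eqOn_or_eqOn_of_forall {β b t : ℝ → ℝ} (hβ : ContinuousOn β (Icc 0 1))
    (hb : ContinuousOn b (Icc 0 1)) (ht : ContinuousOn t (Icc 0 1))
    (hbt : ∀ x ∈ Icc (0 : ℝ) 1, b x < t x) (h : ∀ x ∈ Icc (0 : ℝ) 1, β x = b x ∨ β x = t x) :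
    EqOn β b (Icc 0 1) ∨ EqOn β t (Icc 0 1) := by
  have hpre : IsPreconnected (Icc (0 : ℝ) 1) := isPreconnected_Icc
  -- `2β - (b + t)` equals `±(t - b)` pointwise. As `t - b` never vanishes, connectedness fixes the
  -- sign.
  have := hpre.eq_or_eq_neg_of_sq_eq (f := fun x => 2 * β x - (b x + t x))
    (g := fun x => t x - b x)
    ((continuousOn_const.mul hβ).sub (hb.add ht)) (ht.sub hb)
    (fun x hx => by
      rcases h x hx with e | e <;> simp only [Pi.pow_apply, e] <;> ring)
    (fun {x} hx => by have := hbt x hx; intro h0; linarith)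
  rcases this with h' | h'
  · right; intro x hx; have := h' hx; simp only at this; linarith
  · left; intro x hx; have := h' hx; simp only [Pi.neg_apply] at this; linarith

namespace MarkovSystem

variable {ι : Type*} (M : MarkovSystem ι)

theorem mem_E {i : ι} {z : ℝ × ℝ} :
    z ∈ M.E i ↔ z.2 ∈ Icc (0 : ℝ) 1 ∧ z.1 ∈ Icc (M.left i z.2) (M.right i z.2) := Iff.rfl

theorem E_subset_Q (i : ι) : M.E i ⊆ Q := fun z hz => by
  have h := M.left_right i z.2 hz.1
  exact ⟨⟨h.1.trans hz.2.1, hz.2.2.trans h.2.2⟩, hz.1⟩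

theorem S_subset_Q (i : ι) : M.S i ⊆ Q := fun z hz => by
  have h := M.bottom_top i z.1 hz.1
  exact ⟨hz.1, ⟨h.1.trans hz.2.1, hz.2.2.trans h.2.2⟩⟩

theorem map_E {i : ι} {z : ℝ × ℝ} (hz : z ∈ M.E i) : M.f i z ∈ M.S i := by
  have : M.f i z ∈ M.f i '' fullHeight (M.left i) (M.right i) := mem_image_of_mem _ hz
  rwa [M.image_eq] at this

theorem exists_of_mem_S {i : ι} {w : ℝ × ℝ} (hw : w ∈ M.S i) : ∃ z ∈ M.E i, M.f i z = w := by
  have h : w ∈ M.f i '' fullHeight (M.left i) (M.right i) := by rw [M.image_eq]; exact hw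
  exact h

theorem mem_source {i : ι} {z : ℝ × ℝ} (hz : z ∈ M.E i) : z ∈ (M.f i).source :=
  M.subset_source i hz

theorem injOn_E (i : ι) : InjOn (M.f i) (M.E i) :=
  (M.f i).injOn.mono (M.subset_source i)

theorem continuousOn_E (i : ι) : ContinuousOn (M.f i) (M.E i) :=
  (M.f i).continuousOn.mono (M.subset_source i)

theorem contDiffAt {i : ι} {z : ℝ × ℝ} (hz : z ∈ M.E i) : ContDiffAt ℝ 2 (M.f i) z :=
  (M.contDiffOn i).contDiffAt ((M.f i).open_source.mem_nhds (M.mem_source hz))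

theorem differentiableAt {i : ι} {z : ℝ × ℝ} (hz : z ∈ M.E i) :
    DifferentiableAt ℝ (M.f i) z :=
  (M.contDiffAt hz).differentiableAt (by norm_num)

variable {M} {α K₀ : ℝ}

/-- `h1` is the invariance of the cone: it rearranges to `|F₂ₓ| + α|F₂ᵧ| ≤ α (|F₁ₓ| - α|F₁ᵧ|)`, an
upper bound for the second component of the image against a lower bound for the first. -/
theorem Hyperbolic.cone_fderiv (hM : M.Hyperbolic α K₀) (hα0 : 0 < α)
    {i : ι} {z : ℝ × ℝ} (hz : z ∈ M.E i) {v : ℝ × ℝ} (hv : |v.2| ≤ α * |v.1|) :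
    |(fderiv ℝ (M.f i) z v).2| ≤ α * |(fderiv ℝ (M.f i) z v).1| ∧
      (|(dx (M.f i) z).1| - α * |(dy (M.f i) z).1|) * |v.1| ≤ |(fderiv ℝ (M.f i) z v).1| := by
  rw [fderiv_apply_eq]
  have h1 := hM.h1 i z hz
  set p := dx (M.f i) z
  set q := dy (M.f i) z
  simp only [Prod.fst_add, Prod.snd_add, Prod.smul_fst, Prod.smul_snd, smul_eq_mul]
  have a1 : |v.1| * |p.1| - |v.2| * |q.1| ≤ |v.1 * p.1 + v.2 * q.1| := by
    rw [← abs_mul, ← abs_mul]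
    have := abs_sub_abs_le_abs_sub (v.1 * p.1) (-(v.2 * q.1))
    rwa [abs_neg, sub_neg_eq_add] at this
  have a2 : |v.1 * p.2 + v.2 * q.2| ≤ |v.1| * |p.2| + |v.2| * |q.2| := by
    rw [← abs_mul, ← abs_mul]; exact abs_add_le _ _
  have b1 : |v.2| * |q.1| ≤ α * |v.1| * |q.1| := by gcongr
  have b2 : |v.2| * |q.2| ≤ α * |v.1| * |q.2| := by gcongr
  have h := mul_le_mul_of_nonneg_left h1 (abs_nonneg v.1)
  have a3 := mul_le_mul_of_nonneg_left (a1.trans' (sub_le_sub_left b1 _)) hα0.le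
  constructor
  · nlinarith
  · linarith

theorem Hyperbolic.pair_of_segment (hM : M.Hyperbolic α K₀) (hα0 : 0 < α) (hK₀ : 1 < K₀)
    {i : ι} {z z' : ℝ × ℝ} (hseg : ∀ t ∈ Icc (0 : ℝ) 1, z + t • (z' - z) ∈ M.E i)
    (hcone : |z'.2 - z.2| ≤ α * |z'.1 - z.1|) :
    |(M.f i z').2 - (M.f i z).2| ≤ α * |(M.f i z').1 - (M.f i z).1| ∧
      K₀ * |z'.1 - z.1| ≤ |(M.f i z').1 - (M.f i z).1| :=
  cone_image_of_segment (fun t ht => M.differentiableAt (hseg t ht)) hcone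
    (fun t ht _ hv => (hM.cone_fderiv hα0 (hseg t ht) hv).1)
    (fun t ht v hv => le_trans (by have := hM.h2 i _ (hseg t ht); gcongr)
      (hM.cone_fderiv hα0 (hseg t ht) hv).2) (by linarith)

/-- A horizontal segment between two points of `E i` stays in `E i` whatever the regularity of the
sides. This case starts the argument; `horizontal_pair` needs Lipschitz sides, which are themselves
deduced from this one by duality. -/
theorem Hyperbolic.pair_of_horizontal (hM : M.Hyperbolic α K₀) (hα0 : 0 < α) (hK₀ : 1 < K₀)
    {i : ι} {x x' y : ℝ} (hz : (x, y) ∈ M.E i) (hz' : (x', y) ∈ M.E i) :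
    |(M.f i (x', y)).2 - (M.f i (x, y)).2| ≤ α * |(M.f i (x', y)).1 - (M.f i (x, y)).1| ∧
      K₀ * |x' - x| ≤ |(M.f i (x', y)).1 - (M.f i (x, y)).1| := by
  refine hM.pair_of_segment (z := (x, y)) (z' := (x', y)) hα0 hK₀ (fun t ht => ?_) ?_
  · refine ⟨by simpa using hz.1, ?_⟩
    have := (convex_Icc (M.left i y) (M.right i y)).add_smul_sub_mem hz.2 hz'.2 ht
    simpa using this
  · simp only [sub_self, abs_zero]; positivity

variable (M)

theorem left_mem_E (i : ι) {y : ℝ} (hy : y ∈ Icc (0 : ℝ) 1) : (M.left i y, y) ∈ M.E i :=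
  ⟨hy, le_rfl, (M.left_right i y hy).2.1.le⟩

theorem right_mem_E (i : ι) {y : ℝ} (hy : y ∈ Icc (0 : ℝ) 1) : (M.right i y, y) ∈ M.E i :=
  ⟨hy, (M.left_right i y hy).2.1.le, le_rfl⟩

variable {M}

/-- The two ends of a horizontal section are mapped to opposite sides. -/
theorem Hyperbolic.ends (hM : M.Hyperbolic α K₀) (hα0 : 0 < α) (hK₀ : 1 < K₀)
    (i : ι) {y : ℝ} (hy : y ∈ Icc (0 : ℝ) 1) :
    ((M.f i (M.left i y, y)).1 = 0 ∧ (M.f i (M.right i y, y)).1 = 1) ∨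
      ((M.f i (M.left i y, y)).1 = 1 ∧ (M.f i (M.right i y, y)).1 = 0) := by
  have hl := M.left_mem_E i hy
  have hr := M.right_mem_E i hy
  have h := (hM.pair_of_horizontal hα0 hK₀ hl hr).2
  have hlt := (M.left_right i y hy).2.1
  have hpos : 0 < |(M.f i (M.right i y, y)).1 - (M.f i (M.left i y, y)).1| :=
    lt_of_lt_of_le (mul_pos (by linarith) (abs_pos.2 (by linarith))) h
  have hne := sub_ne_zero.1 (abs_pos.1 hpos)
  rcases M.map_sides i _ hl (Or.inl rfl) with h0 | h0 <;>
    rcases M.map_sides i _ hr (Or.inr rfl) with h1 | h1 <;> rw [h0, h1] at hne <;> simp_all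

/-- A curve that stays in the square between the sides meets the image of every horizontal
section. -/
theorem Hyperbolic.exists_on_section (hM : M.Hyperbolic α K₀) (hα0 : 0 < α) (hK₀ : 1 < K₀)
    (i : ι) {y : ℝ} (hy : y ∈ Icc (0 : ℝ) 1) {h : ℝ → ℝ} (hc : ContinuousOn h (Icc 0 1))
    (hh : ∀ y ∈ Icc (0 : ℝ) 1, h y ∈ Icc (0 : ℝ) 1) :
    ∃ x, (x, y) ∈ M.E i ∧ (M.f i (x, y)).1 = h (M.f i (x, y)).2 := by
  have hlt := (M.left_right i y hy).2.1
  have hmem : ∀ x ∈ Icc (M.left i y) (M.right i y), (x, y) ∈ M.E i := fun x hx => ⟨hy, hx⟩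
  have hQ : ∀ x ∈ Icc (M.left i y) (M.right i y), M.f i (x, y) ∈ Q := fun x hx =>
    M.S_subset_Q i (M.map_E (hmem x hx))
  have hf : ContinuousOn (fun x => M.f i (x, y)) (Icc (M.left i y) (M.right i y)) :=
    (M.continuousOn_E i).comp (by fun_prop) hmem
  have hu : ContinuousOn (fun x => (M.f i (x, y)).1 - h (M.f i (x, y)).2)
      (Icc (M.left i y) (M.right i y)) :=
    (continuous_fst.comp_continuousOn hf).sub
      (hc.comp (continuous_snd.comp_continuousOn hf) fun x hx => (hQ x hx).2)
  have hl := hh _ (hQ _ (left_mem_Icc.2 hlt.le)).2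
  have hr := hh _ (hQ _ (right_mem_Icc.2 hlt.le)).2
  have key : (0 : ℝ) ∈ (fun x => (M.f i (x, y)).1 - h (M.f i (x, y)).2) ''
      Icc (M.left i y) (M.right i y) := by
    rcases hM.ends hα0 hK₀ i hy with ⟨h0, h1⟩ | ⟨h0, h1⟩
    · refine intermediate_value_Icc hlt.le hu ⟨?_, ?_⟩
      · simp only [h0]; linarith [hl.1]
      · simp only [h1]; linarith [hr.2]
    · refine intermediate_value_Icc' hlt.le hu ⟨?_, ?_⟩
      · simp only [h1]; linarith [hr.1]
      · simp only [h0]; linarith [hl.2]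
  obtain ⟨x, hx, h0⟩ := key
  exact ⟨x, hmem x hx, sub_eq_zero.1 h0⟩

/-- Only points of the sides are mapped to the sides of the square. -/
theorem Hyperbolic.mem_sides (hM : M.Hyperbolic α K₀) (hα0 : 0 < α) (hK₀ : 1 < K₀)
    {i : ι} {z : ℝ × ℝ} (hz : z ∈ M.E i) (h : (M.f i z).1 = 0 ∨ (M.f i z).1 = 1) :
    z.1 = M.left i z.2 ∨ z.1 = M.right i z.2 := by
  obtain ⟨x, y⟩ := z
  have hl := (hM.pair_of_horizontal hα0 hK₀ (M.left_mem_E i hz.1) hz).2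
  have hr := (hM.pair_of_horizontal hα0 hK₀ (M.right_mem_E i hz.1) hz).2
  have aux : ∀ {s : ℝ}, K₀ * |s| ≤ 0 → s = 0 := fun {s} hs => by
    by_contra hne
    have : 0 < K₀ * |s| := mul_pos (by linarith) (abs_pos.2 hne)
    linarith
  rcases hM.ends hα0 hK₀ i hz.1 with ⟨h0, h1⟩ | ⟨h0, h1⟩ <;> rcases h with h | h
  · left; rw [h, h0] at hl; have := aux (by simpa using hl); simp only; linarith
  · right; rw [h, h1] at hr; have := aux (by simpa using hr); simp only; linarith
  · right; rw [h, h1] at hr; have := aux (by simpa using hr); simp only; linarith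
  · left; rw [h, h0] at hl; have := aux (by simpa using hl); simp only; linarith

/-- The image of a horizontal edge is the lower or the upper boundary of the strip. -/
theorem Hyperbolic.edge_image (hM : M.Hyperbolic α K₀) (hα0 : 0 < α) (hK₀ : 1 < K₀)
    (i : ι) {y : ℝ} (hy : y = 0 ∨ y = 1) :
    ∃ β ξ : ℝ → ℝ, (∀ x ∈ Icc (0 : ℝ) 1, (ξ x, y) ∈ M.E i ∧ M.f i (ξ x, y) = (x, β x)) ∧
      (∀ x ∈ Icc (0 : ℝ) 1, ∀ x' ∈ Icc (0 : ℝ) 1, |β x' - β x| ≤ α * |x' - x|) ∧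
      (EqOn β (M.bottom i) (Icc 0 1) ∨ EqOn β (M.top i) (Icc 0 1)) := by
  have hy' : y ∈ Icc (0 : ℝ) 1 := by rcases hy with rfl | rfl <;> simp
  -- The curve here is the vertical line over `x`.
  have hex : ∀ x ∈ Icc (0 : ℝ) 1, ∃ s, (s, y) ∈ M.E i ∧ (M.f i (s, y)).1 = x := fun x hx =>
    hM.exists_on_section hα0 hK₀ i hy' (h := fun _ => x) continuousOn_const fun _ _ => hx
  choose! ξ hξ using hex
  set β : ℝ → ℝ := fun x => (M.f i (ξ x, y)).2
  have hlip : ∀ x ∈ Icc (0 : ℝ) 1, ∀ x' ∈ Icc (0 : ℝ) 1, |β x' - β x| ≤ α * |x' - x| :=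
    fun x hx x' hx' => by
      have := (hM.pair_of_horizontal hα0 hK₀ (hξ x hx).1 (hξ x' hx').1).1
      rwa [(hξ x hx).2, (hξ x' hx').2] at this
  have hcont : ContinuousOn β (Icc 0 1) := by
    have : LipschitzOnWith α.toNNReal β (Icc 0 1) :=
      LipschitzOnWith.of_dist_le_mul fun x hx x' hx' => by
        rw [Real.dist_eq, Real.dist_eq, Real.coe_toNNReal _ hα0.le]
        exact hlip x' hx' x hx
    exact this.continuousOn
  refine ⟨β, ξ, fun x hx => ⟨(hξ x hx).1, Prod.ext (hξ x hx).2 rfl⟩, hlip, ?_⟩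
  refine eqOn_or_eqOn_of_forall hcont (M.bottom_cont i) (M.top_cont i)
    (fun x hx => (M.bottom_top i x hx).2.1) fun x hx => ?_
  have := M.map_top_bottom i _ (hξ x hx).1 hy
  rwa [(hξ x hx).2] at this

/-- The lower and upper boundaries of a strip are Lipschitz and are the images of the horizontal
edges. -/
theorem Hyperbolic.boundary (hM : M.Hyperbolic α K₀) (hα0 : 0 < α) (hK₀ : 1 < K₀) (i : ι) :
    (∀ x ∈ Icc (0 : ℝ) 1, ∀ x' ∈ Icc (0 : ℝ) 1,
      |M.bottom i x' - M.bottom i x| ≤ α * |x' - x|) ∧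
    (∀ x ∈ Icc (0 : ℝ) 1, ∀ x' ∈ Icc (0 : ℝ) 1, |M.top i x' - M.top i x| ≤ α * |x' - x|) ∧
    (∀ z ∈ M.E i, (M.f i z).2 = M.bottom i (M.f i z).1 ∨ (M.f i z).2 = M.top i (M.f i z).1 →
      z.2 = 0 ∨ z.2 = 1) := by
  obtain ⟨β₀, ξ₀, h₀, l₀, e₀⟩ := hM.edge_image hα0 hK₀ i (y := 0) (Or.inl rfl)
  obtain ⟨β₁, ξ₁, h₁, l₁, e₁⟩ := hM.edge_image hα0 hK₀ i (y := 1) (Or.inr rfl)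
  have hne : ∀ x ∈ Icc (0 : ℝ) 1, β₀ x ≠ β₁ x := fun x hx he => by
    have : (ξ₀ x, (0 : ℝ)) = (ξ₁ x, (1 : ℝ)) :=
      M.injOn_E i (h₀ x hx).1 (h₁ x hx).1 (by rw [(h₀ x hx).2, (h₁ x hx).2, he])
    simpa using congrArg Prod.snd this
  have h01 : (0 : ℝ) ∈ Icc (0 : ℝ) 1 := by simp
  have key : ∀ {β ξ : ℝ → ℝ} {y : ℝ}, (y = 0 ∨ y = 1) →
      (∀ x ∈ Icc (0 : ℝ) 1, (ξ x, y) ∈ M.E i ∧ M.f i (ξ x, y) = (x, β x)) →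
      ∀ z ∈ M.E i, (M.f i z).2 = β (M.f i z).1 → z.2 = 0 ∨ z.2 = 1 := by
    intro β ξ y hy h z hz hzb
    have hx := (M.map_E hz).1
    have : z = (ξ (M.f i z).1, y) :=
      M.injOn_E i hz (h _ hx).1 (by rw [(h _ hx).2]; exact Prod.ext rfl hzb)
    rw [this]; exact hy
  have lip : ∀ {β b : ℝ → ℝ}, EqOn β b (Icc 0 1) →
      (∀ x ∈ Icc (0 : ℝ) 1, ∀ x' ∈ Icc (0 : ℝ) 1, |β x' - β x| ≤ α * |x' - x|) →
      ∀ x ∈ Icc (0 : ℝ) 1, ∀ x' ∈ Icc (0 : ℝ) 1, |b x' - b x| ≤ α * |x' - x| :=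
    fun he hl x hx x' hx' => by rw [← he hx, ← he hx']; exact hl x hx x' hx'
  -- Injectivity (`hne`) prevents both edges from going to the same boundary curve; either
  -- orientation is possible.
  rcases e₀ with e₀ | e₀ <;> rcases e₁ with e₁ | e₁
  · exact absurd ((e₀ h01).trans (e₁ h01).symm) (hne 0 h01)
  · refine ⟨lip e₀ l₀, lip e₁ l₁, fun z hz h => ?_⟩
    have hx := (M.map_E hz).1
    rcases h with h | h
    · exact key (Or.inl rfl) h₀ z hz (h.trans (e₀ hx).symm)
    · exact key (Or.inr rfl) h₁ z hz (h.trans (e₁ hx).symm)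
  · refine ⟨lip e₁ l₁, lip e₀ l₀, fun z hz h => ?_⟩
    have hx := (M.map_E hz).1
    rcases h with h | h
    · exact key (Or.inr rfl) h₁ z hz (h.trans (e₁ hx).symm)
    · exact key (Or.inl rfl) h₀ z hz (h.trans (e₀ hx).symm)
  · exact absurd ((e₀ h01).trans (e₁ h01).symm) (hne 0 h01)

end MarkovSystem

/-! ### The dual system and time reversal -/

namespace MarkovSystem

variable {ι : Type*} {M : MarkovSystem ι} {α K₀ : ℝ}

theorem symm_map {i : ι} {z : ℝ × ℝ} (hz : z ∈ M.E i) : (M.f i).symm (M.f i z) = z :=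
  (M.f i).left_inv (M.mem_source hz)

variable (M) in
theorem S_subset_target (i : ι) : M.S i ⊆ (M.f i).target := fun w hw => by
  obtain ⟨z, hz, rfl⟩ := M.exists_of_mem_S hw
  exact (M.f i).map_source (M.mem_source hz)

theorem symm_mem_E {i : ι} {w : ℝ × ℝ} (hw : w ∈ M.S i) : (M.f i).symm w ∈ M.E i := by
  obtain ⟨z, hz, rfl⟩ := M.exists_of_mem_S hw
  rwa [symm_map hz]

theorem map_symm {i : ι} {w : ℝ × ℝ} (hw : w ∈ M.S i) : M.f i ((M.f i).symm w) = w :=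
  (M.f i).right_inv (M.S_subset_target i hw)

/-- The system of the inverse maps, with the coordinates exchanged. -/
def Hyperbolic.dual (hM : M.Hyperbolic α K₀) (hα0 : 0 < α) (hK₀ : 1 < K₀) : MarkovSystem ι where
  left := M.bottom
  right := M.top
  bottom := M.left
  top := M.right
  f i := ((Homeomorph.prodComm ℝ ℝ).toOpenPartialHomeomorph.trans (M.f i).symm).trans
    (Homeomorph.prodComm ℝ ℝ).toOpenPartialHomeomorph
  left_cont := M.bottom_cont
  right_cont := M.top_cont
  bottom_cont := M.left_cont
  top_cont := M.right_cont
  left_right := M.bottom_top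
  bottom_top := M.left_right
  subset_source i z hz := by
    have : z.swap ∈ M.S i := hz
    have := M.S_subset_target i this
    simpa using this
  contDiffOn i := by
    have h : ContDiff ℝ 2 (Prod.swap : ℝ × ℝ → ℝ × ℝ) := contDiff_snd.prodMk contDiff_fst
    have h' := h.comp_contDiffOn ((M.contDiffOn_symm i).comp h.contDiffOn
      (s := Prod.swap ⁻¹' (M.f i).target) fun z hz => hz)
    simpa using h'
  contDiffOn_symm i := by
    have h : ContDiff ℝ 2 (Prod.swap : ℝ × ℝ → ℝ × ℝ) := contDiff_snd.prodMk contDiff_fst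
    have h' := h.comp_contDiffOn ((M.contDiffOn i).comp h.contDiffOn
      (s := Prod.swap ⁻¹' (M.f i).source) fun z hz => hz)
    simpa [Function.comp_assoc] using h'
  image_eq i := by
    ext w
    constructor
    · rintro ⟨z, hz, rfl⟩
      have : z.swap ∈ M.S i := hz
      exact symm_mem_E this
    · intro hw
      have hw' : w.swap ∈ M.E i := hw
      refine ⟨(M.f i w.swap).swap, M.map_E hw', ?_⟩
      simp [symm_map hw']
  -- For the inverse maps the boundary conditions are the converses of those in the structure: only
  -- boundary points go to the boundary. Hyperbolicity supplies them, through `boundary` and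
  -- `mem_sides`.
  map_sides i z hz h := by
    have hz' : z.swap ∈ M.S i := hz
    have := (hM.boundary hα0 hK₀ i).2.2 _ (symm_mem_E hz')
    rw [map_symm hz'] at this
    exact this h
  map_top_bottom i z hz h := by
    have hz' : z.swap ∈ M.S i := hz
    have := hM.mem_sides hα0 hK₀ (symm_mem_E hz')
    rw [map_symm hz'] at this
    exact this h

section Dual

variable (hM : M.Hyperbolic α K₀) (hα0 : 0 < α) (hK₀ : 1 < K₀)

theorem dual_f_apply (i : ι) (z : ℝ × ℝ) :
    (hM.dual hα0 hK₀).f i z = ((M.f i).symm z.swap).swap := rfl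

theorem mem_dual_E {i : ι} {z : ℝ × ℝ} : z ∈ (hM.dual hα0 hK₀).E i ↔ z.swap ∈ M.S i := Iff.rfl

/-- Cramer's rule, from `D(f⁻¹) ∘ Df = id` applied to the columns of the adjugate. A zero
determinant would force `F₁ₓ = 0`, against `h2`. -/
theorem Hyperbolic.det_ne_zero (hM : M.Hyperbolic α K₀) (hα0 : 0 < α) (hK₀ : 1 < K₀)
    {i : ι} {z : ℝ × ℝ} (hz : z ∈ M.E i) :
    (dx (M.f i) z).1 * (dy (M.f i) z).2 - (dy (M.f i) z).1 * (dx (M.f i) z).2 ≠ 0 ∧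
    (fderiv ℝ (M.f i).symm (M.f i z) (1, 0) =
      ((dx (M.f i) z).1 * (dy (M.f i) z).2 - (dy (M.f i) z).1 * (dx (M.f i) z).2)⁻¹ •
        ((dy (M.f i) z).2, - (dx (M.f i) z).2)) ∧
    (fderiv ℝ (M.f i).symm (M.f i z) (0, 1) =
      ((dx (M.f i) z).1 * (dy (M.f i) z).2 - (dy (M.f i) z).1 * (dx (M.f i) z).2)⁻¹ •
        (-(dy (M.f i) z).1, (dx (M.f i) z).1)) := by
  have hs := M.mem_source hz
  have hG : DifferentiableAt ℝ (M.f i).symm (M.f i z) :=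
    ((M.contDiffOn_symm i).contDiffAt
      ((M.f i).open_target.mem_nhds ((M.f i).map_source hs))).differentiableAt (by norm_num)
  have hcomp := hG.hasFDerivAt.comp z (M.differentiableAt hz).hasFDerivAt
  have hid : HasFDerivAt ((M.f i).symm ∘ M.f i) (ContinuousLinearMap.id ℝ (ℝ × ℝ)) z :=
    (hasFDerivAt_id z).congr_of_eventuallyEq
      ((M.f i).eventually_left_inverse hs)
  have hBA : ∀ v, fderiv ℝ (M.f i).symm (M.f i z) (fderiv ℝ (M.f i) z v) = v := fun v => by
    have := congrArg (fun L => L v) (hcomp.unique hid)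
    simpa using this
  have h2 := hM.h2 i z hz
  set B := fderiv ℝ (M.f i).symm (M.f i z)
  have e1 := hBA ((dy (M.f i) z).2, - (dx (M.f i) z).2)
  have e2 := hBA (-(dy (M.f i) z).1, (dx (M.f i) z).1)
  rw [fderiv_apply_eq (M.f i)] at e1 e2
  set p := dx (M.f i) z
  set q := dy (M.f i) z
  set d := p.1 * q.2 - q.1 * p.2 with hd
  have k1 : q.2 • p + (-p.2) • q = d • ((1, 0) : ℝ × ℝ) := by
    ext <;> simp [hd] <;> ring
  have k2 : (-q.1) • p + p.1 • q = d • ((0, 1) : ℝ × ℝ) := by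
    ext <;> simp [hd] <;> ring
  simp only [k1, k2, map_smul] at e1 e2
  have hd0 : d ≠ 0 := fun h0 => by
    rw [h0, zero_smul] at e2
    have h3 := congrArg Prod.snd e2
    simp only [Prod.snd_zero] at h3
    rw [← h3, abs_zero] at h2
    have := mul_nonneg hα0.le (abs_nonneg q.1)
    linarith
  refine ⟨hd0, ?_, ?_⟩
  · rw [← e1, smul_smul, inv_mul_cancel₀ hd0, one_smul]
  · rw [← e2, smul_smul, inv_mul_cancel₀ hd0, one_smul]

theorem dual_derivs {i : ι} {z : ℝ × ℝ} (hz : z ∈ M.E i) :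
    dx ((hM.dual hα0 hK₀).f i) (M.f i z).swap =
      ((dx (M.f i) z).1 * (dy (M.f i) z).2 - (dy (M.f i) z).1 * (dx (M.f i) z).2)⁻¹ •
        ((dx (M.f i) z).1, -(dy (M.f i) z).1) ∧
    dy ((hM.dual hα0 hK₀).f i) (M.f i z).swap =
      ((dx (M.f i) z).1 * (dy (M.f i) z).2 - (dy (M.f i) z).1 * (dx (M.f i) z).2)⁻¹ •
        (-(dx (M.f i) z).2, (dy (M.f i) z).2) := by
  obtain ⟨-, h1, h2⟩ := hM.det_ne_zero hα0 hK₀ hz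
  have hG : DifferentiableAt ℝ (M.f i).symm (M.f i z) :=
    ((M.contDiffOn_symm i).contDiffAt
      ((M.f i).open_target.mem_nhds ((M.f i).map_source (M.mem_source hz)))).differentiableAt
        (by norm_num)
  let L : (ℝ × ℝ) →L[ℝ] (ℝ × ℝ) :=
    (ContinuousLinearMap.snd ℝ ℝ ℝ).prod (ContinuousLinearMap.fst ℝ ℝ ℝ)
  have hF : HasFDerivAt ((hM.dual hα0 hK₀).f i)
      (L.comp ((fderiv ℝ (M.f i).symm (M.f i z)).comp L)) (M.f i z).swap :=
    L.hasFDerivAt.comp (M.f i z).swap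
      (HasFDerivAt.comp (g := (M.f i).symm) (M.f i z).swap hG.hasFDerivAt L.hasFDerivAt)
  constructor
  · rw [dx, hF.fderiv]
    have : L ((1, 0) : ℝ × ℝ) = (0, 1) := rfl
    rw [ContinuousLinearMap.comp_apply, ContinuousLinearMap.comp_apply, this, h2]
    rfl
  · rw [dy, hF.fderiv]
    have : L ((0, 1) : ℝ × ℝ) = (1, 0) := rfl
    rw [ContinuousLinearMap.comp_apply, ContinuousLinearMap.comp_apply, this, h1]
    rfl

/-- The hypotheses are symmetric under time reversal: dividing the entries by the determinant
exchanges `h1` with `h3` and `h2` with `h4`, and inverts the Jacobian. -/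
theorem dual_hyperbolic : (hM.dual hα0 hK₀).Hyperbolic α K₀ := by
  have key : ∀ i, ∀ z ∈ (hM.dual hα0 hK₀).E i, ∃ w ∈ M.E i, z = (M.f i w).swap := by
    intro i z hz
    obtain ⟨w, hw, h⟩ := M.exists_of_mem_S ((mem_dual_E hM hα0 hK₀).1 hz)
    exact ⟨w, hw, by rw [h, Prod.swap_swap]⟩
  refine ⟨?_, ?_, ?_, ?_, hM.h5⟩ <;> intro i z hz <;> obtain ⟨w, hw, rfl⟩ := key i z hz <;>
    obtain ⟨hd, -, -⟩ := hM.det_ne_zero hα0 hK₀ hw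
  · obtain ⟨e1, e2⟩ := dual_derivs hM hα0 hK₀ hw
    have h3 := hM.h3 i w hw
    rw [e1, e2]
    simp only [Prod.smul_fst, Prod.smul_snd, smul_eq_mul, abs_mul, abs_neg]
    have := mul_le_mul_of_nonneg_left h3 (abs_nonneg
      ((dx (M.f i) w).1 * (dy (M.f i) w).2 - (dy (M.f i) w).1 * (dx (M.f i) w).2)⁻¹)
    linarith
  · obtain ⟨e1, e2⟩ := dual_derivs hM hα0 hK₀ hw
    have h4 := hM.h4 i w hw
    rw [jac] at h4
    rw [e1, e2]
    simp only [Prod.smul_fst, smul_eq_mul, abs_mul, abs_neg, abs_inv]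
    have hd' := abs_pos.2 hd
    set d := |(dx (M.f i) w).1 * (dy (M.f i) w).2 - (dy (M.f i) w).1 * (dx (M.f i) w).2|
    have := mul_le_mul_of_nonneg_left h4 (inv_nonneg.2 hd'.le)
    rw [← mul_assoc, inv_mul_cancel₀ hd'.ne', one_mul] at this
    linarith
  · obtain ⟨e1, e2⟩ := dual_derivs hM hα0 hK₀ hw
    have h1 := hM.h1 i w hw
    rw [e1, e2]
    simp only [Prod.smul_fst, Prod.smul_snd, smul_eq_mul, abs_mul, abs_neg]
    have := mul_le_mul_of_nonneg_left h1 (abs_nonneg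
      ((dx (M.f i) w).1 * (dy (M.f i) w).2 - (dy (M.f i) w).1 * (dx (M.f i) w).2)⁻¹)
    linarith
  · obtain ⟨e1, e2⟩ := dual_derivs hM hα0 hK₀ hw
    have h2 := hM.h2 i w hw
    rw [jac, e1, e2]
    simp only [Prod.smul_fst, Prod.smul_snd, smul_eq_mul]
    set p := dx (M.f i) w
    set q := dy (M.f i) w
    set d := p.1 * q.2 - q.1 * p.2 with hdd
    have : d⁻¹ * p.1 * (d⁻¹ * q.2) - d⁻¹ * -p.2 * (d⁻¹ * -q.1) = d⁻¹ := by
      have : d⁻¹ * p.1 * (d⁻¹ * q.2) - d⁻¹ * -p.2 * (d⁻¹ * -q.1) = d⁻¹ * (d⁻¹ * d) := by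
        rw [hdd]; ring
      rw [this, inv_mul_cancel₀ hd, mul_one]
    rw [this]
    simp only [abs_mul, abs_neg]
    have := mul_le_mul_of_nonneg_left h2 (abs_nonneg d⁻¹)
    linarith

theorem dual_cylinder (p : ℕ → ι) (m : ℕ) (z : ℝ × ℝ) :
    z ∈ (hM.dual hα0 hK₀).cylinder p m ↔ z.swap ∈ M.strip p m := by
  induction m generalizing p z with
  | zero => simp only [cylinder, strip, Q, mem_prod]; exact and_comm
  | succ m ih =>
    simp only [cylinder, strip, mem_inter_iff, mem_preimage, ih, mem_image, mem_dual_E,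
      dual_f_apply, Prod.swap_swap]
    constructor
    · rintro ⟨h1, h2⟩
      exact ⟨_, ⟨h2, symm_mem_E h1⟩, map_symm h1⟩
    · rintro ⟨w, ⟨h1, h2⟩, h⟩
      rw [← h, symm_map h2]
      exact ⟨M.map_E h2, h1⟩

theorem mem_unstable_iff (p : ℕ → ι) (z : ℝ × ℝ) :
    z ∈ M.unstable p ↔ z.swap ∈ (hM.dual hα0 hK₀).stable p := by
  simp only [unstable, stable, mem_iInter, dual_cylinder, Prod.swap_swap]

end Dual

/-! ### Pairs of points in horizontal or vertical position -/

/-- The sides of a full height rectangle are Lipschitz. -/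
theorem Hyperbolic.sides_lipschitz (hM : M.Hyperbolic α K₀) (hα0 : 0 < α) (hK₀ : 1 < K₀) (i : ι) :
    (∀ x ∈ Icc (0 : ℝ) 1, ∀ x' ∈ Icc (0 : ℝ) 1, |M.left i x' - M.left i x| ≤ α * |x' - x|) ∧
    (∀ x ∈ Icc (0 : ℝ) 1, ∀ x' ∈ Icc (0 : ℝ) 1, |M.right i x' - M.right i x| ≤ α * |x' - x|) :=
  have h := (dual_hyperbolic hM hα0 hK₀).boundary hα0 hK₀ i
  ⟨h.1, h.2.1⟩

/-- Pairs of points of `E i` in horizontal position are mapped to such pairs, with expansion. -/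
theorem Hyperbolic.horizontal_pair (hM : M.Hyperbolic α K₀) (hα0 : 0 < α) (hα1 : α < 1)
    (hK₀ : 1 < K₀) {i : ι} {z z' : ℝ × ℝ} (hz : z ∈ M.E i) (hz' : z' ∈ M.E i)
    (hcone : |z'.2 - z.2| ≤ α * |z'.1 - z.1|) :
    |(M.f i z').2 - (M.f i z).2| ≤ α * |(M.f i z').1 - (M.f i z).1| ∧
      K₀ * |z'.1 - z.1| ≤ |(M.f i z').1 - (M.f i z).1| := by
  wlog hle : z.1 ≤ z'.1 generalizing z z'
  · have := this hz' hz (by rwa [abs_sub_comm, abs_sub_comm z.1]) (le_of_not_ge hle)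
    rwa [abs_sub_comm, abs_sub_comm (M.f i z).1, abs_sub_comm z.1] at this
  refine hM.pair_of_segment hα0 hK₀ (fun t ht => ?_) hcone
  obtain ⟨hl, hr⟩ := hM.sides_lipschitz hα0 hK₀ i
  set y := z.2 + t * (z'.2 - z.2) with hy
  have hyI : y ∈ Icc (0 : ℝ) 1 := (convex_Icc (0 : ℝ) 1).add_smul_sub_mem hz.1 hz'.1 ht
  have h1 := (abs_le.1 (hl _ hz.1 _ hyI)).2
  have h2 := (abs_le.1 (hr _ hyI _ hz'.1)).2
  have e1 : |y - z.2| = t * |z'.2 - z.2| := by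
    rw [hy, add_sub_cancel_left, abs_mul, abs_of_nonneg ht.1]
  have e2 : |z'.2 - y| = (1 - t) * |z'.2 - z.2| := by
    rw [show z'.2 - y = (1 - t) * (z'.2 - z.2) by rw [hy]; ring, abs_mul,
      abs_of_nonneg (by linarith [ht.2])]
  have hw : 0 ≤ z'.1 - z.1 := by linarith
  rw [abs_of_nonneg hw] at hcone
  -- The sides drift by at most `α` times the height, hence no more than the segment advances
  -- horizontally; so the segment cannot leave `E i`.
  have h3 : α * |z'.2 - z.2| ≤ z'.1 - z.1 := by
    have : α * |z'.2 - z.2| ≤ 1 * |z'.2 - z.2| := by gcongr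
    have : α * (z'.1 - z.1) ≤ 1 * (z'.1 - z.1) := by gcongr
    linarith
  have h4 := mul_le_mul_of_nonneg_left h3 ht.1
  have h5 := mul_le_mul_of_nonneg_left h3 (by linarith [ht.2] : 0 ≤ 1 - t)
  rw [e1] at h1
  rw [e2] at h2
  have hzl := hz.2.1
  have hzr := hz'.2.2
  refine ⟨hyI, ?_, ?_⟩
  · simp only [Prod.snd_add, Prod.smul_snd, Prod.snd_sub, smul_eq_mul, Prod.fst_add,
      Prod.smul_fst, Prod.fst_sub]
    rw [← hy]; linarith
  · simp only [Prod.snd_add, Prod.smul_snd, Prod.snd_sub, smul_eq_mul, Prod.fst_add,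
      Prod.smul_fst, Prod.fst_sub]
    rw [← hy]; linarith

/-- Points of `E i` with images in vertical position are in vertical position, and their vertical
distance is contracted. -/
theorem Hyperbolic.vertical_pair (hM : M.Hyperbolic α K₀) (hα0 : 0 < α) (hα1 : α < 1)
    (hK₀ : 1 < K₀) {i : ι} {z z' : ℝ × ℝ} (hz : z ∈ M.E i) (hz' : z' ∈ M.E i)
    (hcone : |(M.f i z').1 - (M.f i z).1| ≤ α * |(M.f i z').2 - (M.f i z).2|) :
    |z'.1 - z.1| ≤ α * |z'.2 - z.2| ∧
      K₀ * |(M.f i z').2 - (M.f i z).2| ≤ |z'.2 - z.2| := by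
  have h := (dual_hyperbolic hM hα0 hK₀).horizontal_pair hα0 hα1 hK₀ (i := i)
    (z := (M.f i z).swap) (z' := (M.f i z').swap) (M.map_E hz) (M.map_E hz') hcone
  simpa only [dual_f_apply, Prod.swap_swap, Prod.fst_swap, Prod.snd_swap, symm_map hz, symm_map hz'] using h

end MarkovSystem

/-! ### Stable and unstable manifolds as Lipschitz graphs -/

theorem continuousOn_of_abs_le {h : ℝ → ℝ} {α : ℝ} {s : Set ℝ} (hα0 : 0 < α)
    (hl : ∀ y ∈ s, ∀ y' ∈ s, |h y' - h y| ≤ α * |y' - y|) : ContinuousOn h s := by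
  have : LipschitzOnWith α.toNNReal h s :=
    LipschitzOnWith.of_dist_le_mul fun x hx x' hx' => by
      rw [Real.dist_eq, Real.dist_eq, Real.coe_toNNReal _ hα0.le]
      exact hl x' hx' x hx
  exact this.continuousOn

namespace MarkovSystem

variable {ι : Type*} {M : MarkovSystem ι} {α K₀ : ℝ}

/-- The graph transform on near-vertical curves. `exists_on_section` gives a preimage at every
height, and `vertical_pair` gives both the Lipschitz bound and uniqueness. -/
theorem Hyperbolic.graph_pullback (hM : M.Hyperbolic α K₀) (hα0 : 0 < α) (hα1 : α < 1)
    (hK₀ : 1 < K₀) (i : ι) {h : ℝ → ℝ} (hh : ∀ y ∈ Icc (0 : ℝ) 1, h y ∈ Icc (0 : ℝ) 1)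
    (hl : ∀ y ∈ Icc (0 : ℝ) 1, ∀ y' ∈ Icc (0 : ℝ) 1, |h y' - h y| ≤ α * |y' - y|) :
    ∃ h' : ℝ → ℝ,
      (∀ y ∈ Icc (0 : ℝ) 1, ∀ y' ∈ Icc (0 : ℝ) 1, |h' y' - h' y| ≤ α * |y' - y|) ∧
      (∀ y ∈ Icc (0 : ℝ) 1, (h' y, y) ∈ M.E i ∧
        (M.f i (h' y, y)).1 = h (M.f i (h' y, y)).2) ∧
      ∀ z ∈ M.E i, (M.f i z).1 = h (M.f i z).2 → h' z.2 = z.1 := by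
  have hex : ∀ y ∈ Icc (0 : ℝ) 1, ∃ x, (x, y) ∈ M.E i ∧ (M.f i (x, y)).1 = h (M.f i (x, y)).2 :=
    fun y hy => hM.exists_on_section hα0 hK₀ i hy (continuousOn_of_abs_le hα0 hl) hh
  have hpair : ∀ z ∈ M.E i, ∀ z' ∈ M.E i, (M.f i z).1 = h (M.f i z).2 →
      (M.f i z').1 = h (M.f i z').2 → |z'.1 - z.1| ≤ α * |z'.2 - z.2| := by
    intro z hz z' hz' e e'
    refine (hM.vertical_pair hα0 hα1 hK₀ hz hz' ?_).1
    rw [e, e']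
    exact hl _ (M.S_subset_Q i (M.map_E hz)).2 _ (M.S_subset_Q i (M.map_E hz')).2
  choose! h' hh' using hex
  refine ⟨h', fun y hy y' hy' => ?_, hh', fun z hz e => ?_⟩
  · exact hpair _ (hh' y hy).1 _ (hh' y' hy').1 (hh' y hy).2 (hh' y' hy').2
  · have := hpair z hz _ (hh' z.2 hz.1).1 e (hh' z.2 hz.1).2
    simp only [sub_self, abs_zero, mul_zero] at this
    exact sub_eq_zero.1 (abs_nonpos_iff.1 this)

theorem cylinder_subset_Q (q : ℕ → ι) (n : ℕ) : M.cylinder q n ⊆ Q := by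
  cases n with
  | zero => exact subset_rfl
  | succ n => exact fun z hz => M.E_subset_Q _ hz.1

/-- The curve `x = h y` of full height is Lipschitz and stays in `A`. -/
def IsCurveIn (α : ℝ) (A : Set (ℝ × ℝ)) (h : ℝ → ℝ) : Prop :=
  (∀ y ∈ Icc (0 : ℝ) 1, (h y, y) ∈ A) ∧
    ∀ y ∈ Icc (0 : ℝ) 1, ∀ y' ∈ Icc (0 : ℝ) 1, |h y' - h y| ≤ α * |y' - y|

/-- Through the points of a cylinder pass Lipschitz curves of full height. -/
theorem Hyperbolic.exists_curve (hM : M.Hyperbolic α K₀) (hα0 : 0 < α) (hα1 : α < 1)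
    (hK₀ : 1 < K₀) (q : ℕ → ι) (n : ℕ) :
    (∃ h, IsCurveIn α (M.cylinder q n) h) ∧
      ∀ z ∈ M.cylinder q n, ∃ h, IsCurveIn α (M.cylinder q n) h ∧ h z.2 = z.1 := by
  induction n generalizing q with
  | zero =>
    have : ∀ x ∈ Icc (0 : ℝ) 1, IsCurveIn α (M.cylinder q 0) fun _ => x :=
      fun x hx => ⟨fun y hy => ⟨hx, hy⟩, fun y _ y' _ => by
        rw [sub_self, abs_zero]; positivity⟩
    exact ⟨⟨fun _ => 0, this 0 (by simp)⟩, fun z hz => ⟨fun _ => z.1, this z.1 hz.1, rfl⟩⟩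
  | succ n ih =>
    have step : ∀ h : ℝ → ℝ, IsCurveIn α (M.cylinder (fun k => q (k + 1)) n) h →
        ∃ h' : ℝ → ℝ, IsCurveIn α (M.cylinder q (n + 1)) h' ∧
          ∀ z ∈ M.E (q 0), (M.f (q 0) z).1 = h (M.f (q 0) z).2 → h' z.2 = z.1 := by
      rintro h ⟨h1, h2⟩
      obtain ⟨h', l', m', u'⟩ := hM.graph_pullback (h := h) hα0 hα1 hK₀ (q 0)
        (fun y hy => (cylinder_subset_Q _ _ (h1 y hy)).1) h2
      refine ⟨h', ⟨fun y hy => ⟨(m' y hy).1, ?_⟩, l'⟩, u'⟩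
      have := h1 _ (M.S_subset_Q _ (M.map_E (m' y hy).1)).2
      rw [← (m' y hy).2] at this
      exact this
    constructor
    · obtain ⟨h, hh⟩ := (ih fun k => q (k + 1)).1
      obtain ⟨h', hh', -⟩ := step h hh
      exact ⟨h', hh'⟩
    · intro z hz
      obtain ⟨h, hh, e⟩ := (ih fun k => q (k + 1)).2 _ hz.2
      obtain ⟨h', hh', u⟩ := step h hh
      exact ⟨h', hh', u z hz.1 e.symm⟩

/-- Horizontal distances in a cylinder are exponentially small. -/
theorem Hyperbolic.cylinder_width (hM : M.Hyperbolic α K₀) (hα0 : 0 < α) (hα1 : α < 1)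
    (hK₀ : 1 < K₀) (q : ℕ → ι) (n : ℕ) {z z' : ℝ × ℝ} (hz : z ∈ M.cylinder q n)
    (hz' : z' ∈ M.cylinder q n) (hcone : |z'.2 - z.2| ≤ α * |z'.1 - z.1|) :
    K₀ ^ n * |z'.1 - z.1| ≤ 1 := by
  induction n generalizing q z z' with
  | zero =>
    have h1 := (cylinder_subset_Q _ _ hz).1
    have h2 := (cylinder_subset_Q _ _ hz').1
    rw [pow_zero, one_mul, abs_le]
    constructor <;> linarith [h1.1, h1.2, h2.1, h2.2]
  | succ n ih =>
    obtain ⟨c, e⟩ := hM.horizontal_pair hα0 hα1 hK₀ hz.1 hz'.1 hcone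
    have := ih _ hz.2 hz'.2 c
    calc K₀ ^ (n + 1) * |z'.1 - z.1| = K₀ ^ n * (K₀ * |z'.1 - z.1|) := by ring
      _ ≤ K₀ ^ n * |(M.f (q 0) z').1 - (M.f (q 0) z).1| := by gcongr
      _ ≤ 1 := this

/-- Inside the `n`-cylinder a Lipschitz curve through `z` reaches the height of `z'`, at horizontal
distance at most `K₀⁻¹ ^ n` from `z'`. Let `n → ∞`. -/
theorem Hyperbolic.stable_pair (hM : M.Hyperbolic α K₀) (hα0 : 0 < α) (hα1 : α < 1)
    (hK₀ : 1 < K₀) {q : ℕ → ι} {z z' : ℝ × ℝ} (hz : z ∈ M.stable q) (hz' : z' ∈ M.stable q) :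
    |z'.1 - z.1| ≤ α * |z'.2 - z.2| := by
  have hlim : Filter.Tendsto (fun n : ℕ => α * |z'.2 - z.2| + (K₀⁻¹) ^ n) Filter.atTop
      (nhds (α * |z'.2 - z.2| + 0)) :=
    tendsto_const_nhds.add (tendsto_pow_atTop_nhds_zero_of_lt_one (by positivity)
      (inv_lt_one_of_one_lt₀ hK₀))
  rw [add_zero] at hlim
  refine ge_of_tendsto' hlim fun n => ?_
  have hzn := mem_iInter.1 hz n
  have hzn' := mem_iInter.1 hz' n
  obtain ⟨h, ⟨h1, h2⟩, e⟩ := (hM.exists_curve hα0 hα1 hK₀ q n).2 z hzn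
  have hy := (cylinder_subset_Q _ _ hzn).2
  have hy' := (cylinder_subset_Q _ _ hzn').2
  have w := hM.cylinder_width hα0 hα1 hK₀ q n (h1 _ hy') hzn'
    (by simp only [sub_self, abs_zero]; positivity)
  have l := h2 _ hy _ hy'
  rw [e] at l
  have hw : |z'.1 - h z'.2| ≤ K₀⁻¹ ^ n := by
    rw [inv_pow, ← one_div, le_div_iff₀ (by positivity), mul_comm]; exact w
  calc |z'.1 - z.1| = |(h z'.2 - z.1) + (z'.1 - h z'.2)| := by ring_nf
    _ ≤ _ := (abs_add_le _ _).trans (add_le_add l hw)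

theorem isClosed_E (i : ι) : IsClosed (M.E i) := by
  have hI : IsClosed {z : ℝ × ℝ | z.2 ∈ Icc (0 : ℝ) 1} := isClosed_Icc.preimage continuous_snd
  have hL : ContinuousOn (fun z : ℝ × ℝ => z.1 - M.left i z.2) {z | z.2 ∈ Icc (0 : ℝ) 1} :=
    continuousOn_fst.sub ((M.left_cont i).comp continuousOn_snd fun z hz => hz)
  have hR : ContinuousOn (fun z : ℝ × ℝ => M.right i z.2 - z.1) {z | z.2 ∈ Icc (0 : ℝ) 1} :=
    ((M.right_cont i).comp continuousOn_snd fun z hz => hz).sub continuousOn_fst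
  have h1 := hL.preimage_isClosed_of_isClosed hI (isClosed_Ici (a := (0 : ℝ)))
  have h2 := hR.preimage_isClosed_of_isClosed hI (isClosed_Ici (a := (0 : ℝ)))
  convert h1.inter h2 using 1
  ext z
  simp only [mem_E, mem_inter_iff, mem_preimage, mem_Ici, mem_ofPred_eq, sub_nonneg, mem_Icc]
  tauto

theorem isClosed_cylinder (q : ℕ → ι) (n : ℕ) : IsClosed (M.cylinder q n) := by
  induction n generalizing q with
  | zero => exact isClosed_Icc.prod isClosed_Icc
  | succ n ih => exact (M.continuousOn_E _).preimage_isClosed_of_isClosed (isClosed_E _) (ih _)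

theorem cylinder_succ_subset (q : ℕ → ι) (n : ℕ) : M.cylinder q (n + 1) ⊆ M.cylinder q n := by
  induction n generalizing q with
  | zero => exact cylinder_subset_Q q 1
  | succ n ih => exact fun z hz => ⟨hz.1, ih _ hz.2⟩

/-- Cantor's intersection theorem for the horizontal sections of the cylinders, nonempty because
each cylinder contains a curve of full height. -/
theorem Hyperbolic.exists_mem_stable (hM : M.Hyperbolic α K₀) (hα0 : 0 < α) (hα1 : α < 1)
    (hK₀ : 1 < K₀) (q : ℕ → ι) {y : ℝ} (hy : y ∈ Icc (0 : ℝ) 1) : ∃ x, (x, y) ∈ M.stable q := by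
  have hc : ∀ n, IsClosed {x : ℝ | (x, y) ∈ M.cylinder q n} := fun n =>
    (isClosed_cylinder q n).preimage (f := fun x : ℝ => (x, y)) (by fun_prop)
  have hne := IsCompact.nonempty_iInter_of_sequence_nonempty_isCompact_isClosed
    (fun n => {x : ℝ | (x, y) ∈ M.cylinder q n})
    (fun n x hx => cylinder_succ_subset q n hx)
    (fun n => by
      obtain ⟨h, h1, -⟩ := (hM.exists_curve hα0 hα1 hK₀ q n).1
      exact ⟨h y, h1 y hy⟩)
    ((isCompact_Icc (a := (0 : ℝ)) (b := 1)).of_isClosed_subset (hc 0)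
      fun x hx => (cylinder_subset_Q _ _ hx).1)
    hc
  obtain ⟨x, hx⟩ := hne
  exact ⟨x, mem_iInter.2 fun n => mem_iInter.1 hx n⟩

/-- Stable manifolds are Lipschitz graphs over the vertical side. -/
theorem Hyperbolic.stable_graph (hM : M.Hyperbolic α K₀) (hα0 : 0 < α) (hα1 : α < 1)
    (hK₀ : 1 < K₀) (q : ℕ → ι) : ∃ h : ℝ → ℝ,
      (∀ y ∈ Icc (0 : ℝ) 1, ∀ y' ∈ Icc (0 : ℝ) 1, |h y' - h y| ≤ α * |y' - y|) ∧
      M.stable q = {z | z.2 ∈ Icc (0 : ℝ) 1 ∧ z.1 = h z.2} := by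
  choose! h hh using fun y (hy : y ∈ Icc (0 : ℝ) 1) =>
    hM.exists_mem_stable hα0 hα1 hK₀ q hy
  refine ⟨h, fun y hy y' hy' => hM.stable_pair hα0 hα1 hK₀ (hh y hy) (hh y' hy'), ?_⟩
  ext z
  constructor
  · intro hz
    have hy := (cylinder_subset_Q _ _ (mem_iInter.1 hz 0)).2
    have := hM.stable_pair hα0 hα1 hK₀ (hh _ hy) hz
    simp only [sub_self, abs_zero, mul_zero] at this
    exact ⟨hy, sub_eq_zero.1 (abs_nonpos_iff.1 this)⟩
  · rintro ⟨hy, e⟩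
    have := hh _ hy
    rwa [← e] at this

/-- Unstable manifolds are Lipschitz graphs over the horizontal side. -/
theorem Hyperbolic.unstable_graph (hM : M.Hyperbolic α K₀) (hα0 : 0 < α) (hα1 : α < 1)
    (hK₀ : 1 < K₀) (p : ℕ → ι) : ∃ g : ℝ → ℝ,
      (∀ x ∈ Icc (0 : ℝ) 1, ∀ x' ∈ Icc (0 : ℝ) 1, |g x' - g x| ≤ α * |x' - x|) ∧
      M.unstable p = {z | z.1 ∈ Icc (0 : ℝ) 1 ∧ z.2 = g z.1} := by
  obtain ⟨g, hg, e⟩ := (dual_hyperbolic hM hα0 hK₀).stable_graph hα0 hα1 hK₀ p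
  refine ⟨g, hg, ?_⟩
  ext z
  rw [mem_unstable_iff hM hα0 hK₀, e]
  rfl

/-- Injectivity of the last map makes the preimages at all levels one and the same point. -/
theorem exists_preimage_unstable {p : ℕ → ι} {w : ℝ × ℝ} (hw : w ∈ M.unstable p) :
    ∃ z ∈ M.E (p 0), z ∈ (M.unstable fun k => p (k + 1)) ∧ M.f (p 0) z = w := by
  obtain ⟨z, ⟨-, hz⟩, rfl⟩ := mem_iInter.1 hw 1
  refine ⟨z, hz, mem_iInter.2 fun m => ?_, rfl⟩
  obtain ⟨z', ⟨h', hz'⟩, e⟩ := mem_iInter.1 hw (m + 1)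
  rwa [← M.injOn_E _ hz' hz e]

theorem mem_stable_of_map {q : ℕ → ι} {z : ℝ × ℝ} (hE : z ∈ M.E (q 0))
    (hz : M.f (q 0) z ∈ M.stable fun k => q (k + 1)) : z ∈ M.stable q := by
  refine mem_iInter.2 fun n => ?_
  cases n with
  | zero => exact M.E_subset_Q _ hE
  | succ n => exact ⟨hE, mem_iInter.1 hz n⟩

end MarkovSystem

/-! ### Existence of slopes of unstable manifolds -/

/-- The action of the derivative of `F` at `z` on slopes. -/
def slopeMap (F : ℝ × ℝ → ℝ × ℝ) (z : ℝ × ℝ) (a : ℝ) : ℝ :=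
  ((dx F z).2 + a * (dy F z).2) / ((dx F z).1 + a * (dy F z).1)

/-- Near `Z`, the set `W` lies in the cone of radius `δ` about the slope `a`. -/
def ApproxSlope (W : Set (ℝ × ℝ)) (Z : ℝ × ℝ) (a δ : ℝ) : Prop :=
  ∀ᶠ w in nhdsWithin Z W, |w.2 - Z.2 - a * (w.1 - Z.1)| ≤ δ * |w.1 - Z.1|

theorem ApproxSlope.change {W : Set (ℝ × ℝ)} {Z : ℝ × ℝ} {a b δ δ' : ℝ}
    (h : ApproxSlope W Z a δ) (hδ : |a - b| + δ ≤ δ') : ApproxSlope W Z b δ' := by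
  filter_upwards [h] with w hw
  calc |w.2 - Z.2 - b * (w.1 - Z.1)|
      = |(a - b) * (w.1 - Z.1) + (w.2 - Z.2 - a * (w.1 - Z.1))| := by ring_nf
    _ ≤ |a - b| * |w.1 - Z.1| + δ * |w.1 - Z.1| := by
      rw [← abs_mul]; exact (abs_add_le _ _).trans (add_le_add_right hw _)
    _ = (|a - b| + δ) * |w.1 - Z.1| := by ring
    _ ≤ _ := by gcongr

/-- Approximate slopes of a graph, in terms of the function. -/
theorem ApproxSlope.graph {g : ℝ → ℝ} {x a δ : ℝ} (hg : ContinuousOn g (Icc 0 1))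
    (hx : x ∈ Icc (0 : ℝ) 1)
    (h : ApproxSlope {z | z.1 ∈ Icc (0 : ℝ) 1 ∧ z.2 = g z.1} (x, g x) a δ) :
    ∀ᶠ s in nhdsWithin x (Icc 0 1), |g s - g x - a * (s - x)| ≤ δ * |s - x| := by
  have ht : Filter.Tendsto (fun s => (s, g s)) (nhdsWithin x (Icc 0 1))
      (nhdsWithin (x, g x) {z : ℝ × ℝ | z.1 ∈ Icc (0 : ℝ) 1 ∧ z.2 = g z.1}) := by
    refine tendsto_nhdsWithin_iff.2 ⟨?_, ?_⟩
    · exact (continuousWithinAt_id.prodMk (hg x hx)).tendsto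
    · filter_upwards [self_mem_nhdsWithin] with s hs using ⟨hs, rfl⟩
  exact ht.eventually h

/-- Every point of `[0, 1]`, ends included, is an accumulation point, so some `s ≠ x` satisfies both
cone conditions. -/
theorem ApproxSlope.abs_sub_le {g : ℝ → ℝ} {x a b δ δ' : ℝ} (hg : ContinuousOn g (Icc 0 1))
    (hx : x ∈ Icc (0 : ℝ) 1)
    (h : ApproxSlope {z | z.1 ∈ Icc (0 : ℝ) 1 ∧ z.2 = g z.1} (x, g x) a δ)
    (h' : ApproxSlope {z | z.1 ∈ Icc (0 : ℝ) 1 ∧ z.2 = g z.1} (x, g x) b δ') :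
    |a - b| ≤ δ + δ' := by
  have hne : (nhdsWithin x {x}ᶜ ⊓ Filter.principal (Icc (0 : ℝ) 1)).NeBot :=
    uniqueDiffWithinAt_iff_accPt.1 (uniqueDiffOn_Icc_zero_one x hx)
  have hle : nhdsWithin x {x}ᶜ ⊓ Filter.principal (Icc (0 : ℝ) 1) ≤ nhdsWithin x (Icc 0 1) :=
    inf_le_inf_right _ inf_le_left
  have e1 : ∀ᶠ s in nhdsWithin x {x}ᶜ ⊓ Filter.principal (Icc (0 : ℝ) 1), s ≠ x :=
    Filter.Eventually.filter_mono inf_le_left self_mem_nhdsWithin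
  obtain ⟨s, hs, h1, h2⟩ := (e1.and (((h.graph hg hx).filter_mono hle).and
    ((h'.graph hg hx).filter_mono hle))).exists
  have hpos : 0 < |s - x| := abs_pos.2 (sub_ne_zero.2 hs)
  refine le_of_mul_le_mul_right ?_ hpos
  rw [← abs_mul]
  calc |(a - b) * (s - x)|
      = |(g s - g x - b * (s - x)) - (g s - g x - a * (s - x))| := by ring_nf
    _ ≤ |g s - g x - b * (s - x)| + |g s - g x - a * (s - x)| := abs_sub _ _
    _ ≤ (δ + δ') * |s - x| := by linarith

namespace MarkovSystem

variable {ι : Type*} {M : MarkovSystem ι} {α K₀ : ℝ}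

theorem Hyperbolic.width_pos (hM : M.Hyperbolic α K₀) : 0 < 1 - α ^ 2 := by
  have := hM.h5
  have : 0 ≤ 1 / K₀ ^ 2 := by positivity
  linarith

theorem Hyperbolic.expansion_ge (hM : M.Hyperbolic α K₀) (hα0 : 0 < α) {i : ι} {z : ℝ × ℝ}
    (hz : z ∈ M.E i) :
    (1 - α ^ 2) * |(dx (M.f i) z).1| ≤ |(dx (M.f i) z).1| - α * |(dy (M.f i) z).1| := by
  have h3 := hM.h3 i z hz
  have h : |(dy (M.f i) z).1| ≤ α * |(dx (M.f i) z).1| := by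
    have : 0 ≤ α * |(dy (M.f i) z).2| + α ^ 2 * |(dx (M.f i) z).2| := by positivity
    linarith
  nlinarith

theorem Hyperbolic.denom_ge (hM : M.Hyperbolic α K₀) (hα0 : 0 < α) {i : ι} {z : ℝ × ℝ}
    (hz : z ∈ M.E i) {a : ℝ} (ha : |a| ≤ α) :
    |(dx (M.f i) z).1| - α * |(dy (M.f i) z).1| ≤ |(dx (M.f i) z).1 + a * (dy (M.f i) z).1| := by
  have := (hM.cone_fderiv hα0 hz (v := (1, a)) (by simpa using ha)).2
  rw [fderiv_apply_eq] at this
  simpa using this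

theorem Hyperbolic.denom_ne_zero (hM : M.Hyperbolic α K₀) (hα0 : 0 < α) (hK₀ : 1 < K₀) {i : ι}
    {z : ℝ × ℝ} (hz : z ∈ M.E i) {a : ℝ} (ha : |a| ≤ α) :
    (dx (M.f i) z).1 + a * (dy (M.f i) z).1 ≠ 0 := by
  have h1 := hM.denom_ge hα0 hz ha
  have h2 := hM.h2 i z hz
  exact abs_pos.1 (by linarith)

theorem Hyperbolic.abs_slopeMap_le (hM : M.Hyperbolic α K₀) (hα0 : 0 < α) (hK₀ : 1 < K₀) {i : ι}
    {z : ℝ × ℝ} (hz : z ∈ M.E i) {a : ℝ} (ha : |a| ≤ α) : |slopeMap (M.f i) z a| ≤ α := by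
  have := (hM.cone_fderiv hα0 hz (v := (1, a)) (by simpa using ha)).1
  rw [fderiv_apply_eq] at this
  rw [slopeMap, abs_div, div_le_iff₀ (abs_pos.2 (hM.denom_ne_zero hα0 hK₀ hz ha))]
  simpa using this

/-- The Jacobian is small compared with the square of the expansion. -/
theorem Hyperbolic.jac_le (hM : M.Hyperbolic α K₀) (hα0 : 0 < α) (hK₀ : 1 < K₀) {i : ι}
    {z : ℝ × ℝ} (hz : z ∈ M.E i) :
    jac (M.f i) z ≤ 1 / (K₀ ^ 2 * (1 - α ^ 2)) *
      (|(dx (M.f i) z).1| - α * |(dy (M.f i) z).1|) ^ 2 := by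
  have h4 := hM.h4 i z hz
  have hw := hM.width_pos
  have h1 := hM.expansion_ge hα0 hz
  have h2 := hM.h2 i z hz
  set u := |(dx (M.f i) z).1| - α * |(dy (M.f i) z).1|
  have h5 : jac (M.f i) z * K₀ ≤ |(dx (M.f i) z).1| := by
    have : 0 ≤ α * |(dx (M.f i) z).2| := by positivity
    linarith
  rw [one_div, inv_mul_eq_div, le_div_iff₀ (by positivity)]
  calc jac (M.f i) z * (K₀ ^ 2 * (1 - α ^ 2))
      = (jac (M.f i) z * K₀) * (K₀ * (1 - α ^ 2)) := by ring
    _ ≤ |(dx (M.f i) z).1| * (K₀ * (1 - α ^ 2)) := by gcongr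
    _ = K₀ * ((1 - α ^ 2) * |(dx (M.f i) z).1|) := by ring
    _ ≤ u * u := mul_le_mul h2 h1 (by positivity) (by linarith)
    _ = u ^ 2 := by ring

/-- The difference of two values is the Jacobian times `a - b`, over the product of the
denominators; each denominator dominates the expansion appearing in `jac_le`. -/
theorem Hyperbolic.slopeMap_contract (hM : M.Hyperbolic α K₀) (hα0 : 0 < α) (hK₀ : 1 < K₀)
    {i : ι} {z : ℝ × ℝ} (hz : z ∈ M.E i) {a b : ℝ} (ha : |a| ≤ α) (hb : |b| ≤ α) :
    |slopeMap (M.f i) z a - slopeMap (M.f i) z b| ≤ 1 / (K₀ ^ 2 * (1 - α ^ 2)) * |a - b| := by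
  have hJ := hM.jac_le hα0 hK₀ hz
  have hA := hM.denom_ge hα0 hz ha
  have hB := hM.denom_ge hα0 hz hb
  have hA0 := hM.denom_ne_zero hα0 hK₀ hz ha
  have hB0 := hM.denom_ne_zero hα0 hK₀ hz hb
  have h2 := hM.h2 i z hz
  have hw := hM.width_pos
  rw [slopeMap, slopeMap, div_sub_div _ _ hA0 hB0, abs_div, abs_mul (_ + _),
    div_le_iff₀ (mul_pos (abs_pos.2 hA0) (abs_pos.2 hB0))]
  rw [jac] at hJ
  set p := dx (M.f i) z
  set q := dy (M.f i) z
  calc |(p.2 + a * q.2) * (p.1 + b * q.1) - (p.1 + a * q.1) * (p.2 + b * q.2)|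
      = |p.1 * q.2 - q.1 * p.2| * |a - b| := by rw [← abs_mul]; ring_nf
    _ ≤ (1 / (K₀ ^ 2 * (1 - α ^ 2)) * (|p.1| - α * |q.1|) ^ 2) * |a - b| := by gcongr
    _ = 1 / (K₀ ^ 2 * (1 - α ^ 2)) * |a - b| * ((|p.1| - α * |q.1|) * (|p.1| - α * |q.1|)) := by
      ring
    _ ≤ _ := by
      refine mul_le_mul_of_nonneg_left ?_ (by positivity)
      exact mul_le_mul hA hB (by linarith) (abs_nonneg _)

theorem Hyperbolic.unstable_pair (hM : M.Hyperbolic α K₀) (hα0 : 0 < α) (hα1 : α < 1)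
    (hK₀ : 1 < K₀) {p : ℕ → ι} {z z' : ℝ × ℝ} (hz : z ∈ M.unstable p)
    (hz' : z' ∈ M.unstable p) : |z'.2 - z.2| ≤ α * |z'.1 - z.1| :=
  (dual_hyperbolic hM hα0 hK₀).stable_pair hα0 hα1 hK₀
    ((mem_unstable_iff hM hα0 hK₀ p z).1 hz) ((mem_unstable_iff hM hα0 hK₀ p z').1 hz')

/-- The linear part multiplies the radius of the cone by at most `κ`. The gap `θ - κ` absorbs the
linearization error near `z`. -/
theorem Hyperbolic.approxSlope_map (hM : M.Hyperbolic α K₀) (hα0 : 0 < α) (hα1 : α < 1)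
    (hK₀ : 1 < K₀) {θ δ : ℝ} (hθ : 1 / (K₀ ^ 2 * (1 - α ^ 2)) < θ) (hδ : 0 < δ) {p : ℕ → ι}
    {z : ℝ × ℝ} {a : ℝ} (ha : |a| ≤ α) (hE : z ∈ M.E (p 0))
    (hz : z ∈ M.unstable fun k => p (k + 1))
    (h : ApproxSlope (M.unstable fun k => p (k + 1)) z a δ) :
    ApproxSlope (M.unstable p) (M.f (p 0) z) (slopeMap (M.f (p 0)) z a) (θ * δ) := by
  have hw := hM.width_pos
  set θ₁ := 1 / (K₀ ^ 2 * (1 - α ^ 2)) with hθ₁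
  have hθ₁0 : 0 < θ₁ := by positivity
  have hθ0 : 0 < θ := hθ₁0.trans hθ
  -- Chosen so that `θ₁ δ u + 2 ε ≤ θ δ (u - ε)` for every expansion `u ≥ 1`.
  set ε := (θ - θ₁) * δ / (2 + θ * δ) with hε
  have hε0 : 0 < ε := div_pos (mul_pos (by linarith) hδ) (by positivity)
  have hεe : ε * (2 + θ * δ) = (θ - θ₁) * δ := div_mul_cancel₀ _ (by positivity)
  have hlin := (M.differentiableAt hE).hasFDerivAt.isLittleO.def hε0
  have hcone := eventually_nhdsWithin_iff.1 h
  have hback := ((M.f (p 0)).tendsto_symm (M.mem_source hE)).eventually (hlin.and hcone)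
  refine eventually_nhdsWithin_iff.2 ?_
  filter_upwards [hback] with w hw' hwu
  obtain ⟨z', hE', hz', rfl⟩ := exists_preimage_unstable hwu
  rw [symm_map hE'] at hw'
  obtain ⟨hl, hc⟩ := hw'
  have hc := hc hz'
  have hpair := hM.unstable_pair hα0 hα1 hK₀ hz hz'
  have hnorm : ‖z' - z‖ ≤ |z'.1 - z.1| := by
    refine max_le le_rfl ?_
    change |z'.2 - z.2| ≤ _
    refine hpair.trans ?_
    have := mul_le_mul_of_nonneg_right hα1.le (abs_nonneg (z'.1 - z.1))
    linarith
  have hL := (hM.cone_fderiv hα0 hE (v := z' - z) hpair).2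
  have hJ := hM.jac_le hα0 hK₀ hE
  have h2 := hM.h2 _ _ hE
  have hD := hM.denom_ge hα0 hE ha
  have hD0 := hM.denom_ne_zero hα0 hK₀ hE ha
  have hφ := hM.abs_slopeMap_le hα0 hK₀ hE ha
  set F := M.f (p 0)
  set φ := slopeMap F z a with hφd
  set e := F z' - F z - fderiv ℝ F z (z' - z) with he
  have he' : ‖e‖ ≤ ε * |z'.1 - z.1| := hl.trans (by gcongr)
  have he1 : |e.1| ≤ ε * |z'.1 - z.1| := (norm_fst_le e).trans he'
  have he2 : |e.2| ≤ ε * |z'.1 - z.1| := (norm_snd_le e).trans he'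
  set v := z' - z with hv
  have hv1 : v.1 = z'.1 - z.1 := rfl
  have hv2 : v.2 = z'.2 - z.2 := rfl
  have hF1 : (F z').1 - (F z).1 = (fderiv ℝ F z v).1 + e.1 := by simp [he]
  have hF2 : (F z').2 - (F z).2 = (fderiv ℝ F z v).2 + e.2 := by simp [he]
  rw [hF1, hF2]
  rw [← hv1, ← hv2] at hc
  rw [← hv1] at he1 he2
  rw [jac, ← hθ₁] at hJ
  rw [fderiv_apply_eq] at hL ⊢
  set P := dx F z
  set R := dy F z
  simp only [Prod.fst_add, Prod.snd_add, Prod.smul_fst, Prod.smul_snd, smul_eq_mul] at hL ⊢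
  set D := P.1 + a * R.1 with hDd
  set u := |P.1| - α * |R.1| with hu
  have hφD : φ * D = P.2 + a * R.2 := div_mul_cancel₀ _ hD0
  -- The functional `y - φ x` kills the image of `(1, a)`, so on the image of `v` it is a multiple
  -- of `v.2 - a * v.1`.
  have hkey : v.1 * P.2 + v.2 * R.2 - φ * (v.1 * P.1 + v.2 * R.1) =
      (P.1 * R.2 - R.1 * P.2) / D * (v.2 - a * v.1) := by
    rw [div_mul_eq_mul_div, eq_div_iff hD0]
    have : D = P.1 + a * R.1 := rfl
    linear_combination (-(v.1 * P.1 + v.2 * R.1)) * hφD + (v.1 * P.2 + v.2 * R.2) * this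
  have hu1 : 1 < u := by linarith
  have hJD : |(P.1 * R.2 - R.1 * P.2) / D| ≤ θ₁ * u := by
    rw [abs_div, div_le_iff₀ (abs_pos.2 hD0)]
    calc _ ≤ θ₁ * u ^ 2 := hJ
      _ = θ₁ * u * u := by ring
      _ ≤ θ₁ * u * |D| := by gcongr
  have hφ1 : |φ| ≤ 1 := hφ.trans hα1.le
  calc |v.1 * P.2 + v.2 * R.2 + e.2 - φ * (v.1 * P.1 + v.2 * R.1 + e.1)|
      = |(P.1 * R.2 - R.1 * P.2) / D * (v.2 - a * v.1) + (e.2 + -(φ * e.1))| := by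
        rw [← hkey]; ring_nf
    _ ≤ |(P.1 * R.2 - R.1 * P.2) / D| * |v.2 - a * v.1| + (|e.2| + |φ| * |e.1|) := by
        rw [← abs_mul, ← abs_mul, ← abs_neg (φ * e.1)]
        exact (abs_add_le _ _).trans (add_le_add_right (abs_add_le _ _) _)
    _ ≤ θ₁ * u * (δ * |v.1|) + (ε * |v.1| + 1 * (ε * |v.1|)) := by gcongr
    _ = (θ₁ * δ * u + 2 * ε) * |v.1| := by ring
    _ ≤ (θ * δ * (u - ε)) * |v.1| := by
        refine mul_le_mul_of_nonneg_right ?_ (abs_nonneg _)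
        have : (θ - θ₁) * δ * 1 ≤ (θ - θ₁) * δ * u :=
          mul_le_mul_of_nonneg_left hu1.le (mul_nonneg (by linarith) hδ.le)
        linarith
    _ = θ * δ * (u * |v.1| - ε * |v.1|) := by ring
    _ ≤ θ * δ * |v.1 * P.1 + v.2 * R.1 + e.1| := by
        refine mul_le_mul_of_nonneg_left ?_ (by positivity)
        have := abs_sub_abs_le_abs_sub (v.1 * P.1 + v.2 * R.1) (-e.1)
        rw [abs_neg, sub_neg_eq_add] at this
        linarith

theorem Hyperbolic.rate_lt_one (hM : M.Hyperbolic α K₀) (hK₀ : 1 < K₀) :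
    1 / (K₀ ^ 2 * (1 - α ^ 2)) < 1 := by
  have hw := hM.width_pos
  have h5 := hM.h5
  rw [div_lt_one (by positivity)]
  have : 1 / K₀ ^ 2 < 1 - α ^ 2 := by linarith
  rwa [div_lt_iff₀ (by positivity), mul_comm] at this

/-- At the `n`-th preimage, slope `0` with radius `α` is just the Lipschitz bound; each step forward
multiplies the radius by `θ`. -/
theorem Hyperbolic.exists_approxSlope (hM : M.Hyperbolic α K₀) (hα0 : 0 < α) (hα1 : α < 1)
    (hK₀ : 1 < K₀) {θ : ℝ} (hθ : 1 / (K₀ ^ 2 * (1 - α ^ 2)) < θ) (n : ℕ) (p : ℕ → ι)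
    {Z : ℝ × ℝ} (hZ : Z ∈ M.unstable p) :
    ∃ a, |a| ≤ α ∧ ApproxSlope (M.unstable p) Z a (α * θ ^ n) := by
  have hw := hM.width_pos
  have hθ0 : 0 < θ := lt_trans (by positivity) hθ
  induction n generalizing p Z with
  | zero =>
    refine ⟨0, by simpa using hα0.le, ?_⟩
    refine eventually_nhdsWithin_of_forall fun w hw => ?_
    simpa using hM.unstable_pair hα0 hα1 hK₀ hZ hw
  | succ n ih =>
    obtain ⟨z, hE, hz, rfl⟩ := exists_preimage_unstable hZ
    obtain ⟨a, ha, h⟩ := ih _ hz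
    refine ⟨_, hM.abs_slopeMap_le hα0 hK₀ hE ha, ?_⟩
    rw [show α * θ ^ (n + 1) = θ * (α * θ ^ n) by ring]
    exact hM.approxSlope_map hα0 hα1 hK₀ hθ (by positivity) ha hE hz h

theorem Hyperbolic.approxSlope_sub_le (hM : M.Hyperbolic α K₀) (hα0 : 0 < α) (hα1 : α < 1)
    (hK₀ : 1 < K₀) {p : ℕ → ι} {Z : ℝ × ℝ} (hZ : Z ∈ M.unstable p) {a b δ δ' : ℝ}
    (h : ApproxSlope (M.unstable p) Z a δ) (h' : ApproxSlope (M.unstable p) Z b δ') :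
    |a - b| ≤ δ + δ' := by
  obtain ⟨g, hl, e⟩ := hM.unstable_graph hα0 hα1 hK₀ p
  rw [e] at h h' hZ
  obtain ⟨hx, hy⟩ := hZ
  obtain ⟨x, y⟩ := Z
  obtain rfl : y = g x := hy
  exact h.abs_sub_le (continuousOn_of_abs_le hα0 hl) hx h'

/-- Unstable manifolds have slopes. -/
theorem Hyperbolic.exists_slope (hM : M.Hyperbolic α K₀) (hα0 : 0 < α) (hα1 : α < 1)
    (hK₀ : 1 < K₀) (p : ℕ → ι) {Z : ℝ × ℝ} (hZ : Z ∈ M.unstable p) :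
    ∃ a, |a| ≤ α ∧ ∀ δ > 0, ApproxSlope (M.unstable p) Z a δ := by
  obtain ⟨θ, hθ, hθ1⟩ := exists_between (hM.rate_lt_one hK₀)
  have hw := hM.width_pos
  have hθ0 : 0 < θ := lt_trans (by positivity) hθ
  choose a ha h using fun n => hM.exists_approxSlope hα0 hα1 hK₀ hθ n p hZ
  have hmono : ∀ {N n : ℕ}, N ≤ n → α * θ ^ n ≤ α * θ ^ N := fun hn =>
    mul_le_mul_of_nonneg_left (pow_le_pow_of_le_one hθ0.le hθ1.le hn) hα0.le
  have hd : ∀ n m, |a n - a m| ≤ α * θ ^ n + α * θ ^ m := fun n m =>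
    hM.approxSlope_sub_le hα0 hα1 hK₀ hZ (h n) (h m)
  have hlim : Filter.Tendsto (fun N => 2 * (α * θ ^ N)) Filter.atTop (nhds 0) := by
    have := ((tendsto_pow_atTop_nhds_zero_of_lt_one hθ0.le hθ1).const_mul α).const_mul 2
    simpa using this
  have hC : CauchySeq a := cauchySeq_of_le_tendsto_0 _
    (fun n m N hn hm => by
      rw [Real.dist_eq]
      have := hd n m
      have := hmono hn
      have := hmono hm
      linarith) hlim
  obtain ⟨l, hl⟩ := cauchySeq_tendsto_of_complete hC
  refine ⟨l, le_of_tendsto' hl.abs ha, fun δ hδ => ?_⟩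
  have hlim' : Filter.Tendsto (fun N => 3 * (α * θ ^ N)) Filter.atTop (nhds 0) := by
    have := ((tendsto_pow_atTop_nhds_zero_of_lt_one hθ0.le hθ1).const_mul α).const_mul 3
    simpa using this
  -- The factor `3` is one radius `α θ ^ N` plus the distance of at most `2 α θ ^ N` from `a N` to
  -- the limit.
  obtain ⟨N, hN⟩ := (hlim'.eventually (gt_mem_nhds hδ)).exists
  have hlN : |a N - l| ≤ 2 * (α * θ ^ N) := by
    refine le_of_tendsto (hl.const_sub (a N)).abs ?_
    filter_upwards [Filter.eventually_ge_atTop N] with m hm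
    have := hd N m
    have := hmono hm
    linarith
  exact (h N).change (by linarith)

theorem Hyperbolic.isSlope_of_approxSlope (hM : M.Hyperbolic α K₀) (hα0 : 0 < α) (hα1 : α < 1)
    (hK₀ : 1 < K₀) {p : ℕ → ι} {Z : ℝ × ℝ} (hZ : Z ∈ M.unstable p) {a : ℝ}
    (h : ∀ δ > 0, ApproxSlope (M.unstable p) Z a δ) : IsSlope (M.unstable p) Z a := by
  refine ⟨hZ, ?_⟩
  obtain ⟨g, hl, e⟩ := hM.unstable_graph hα0 hα1 hK₀ p
  refine ⟨g, e, ?_⟩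
  rw [e] at h hZ
  obtain ⟨hx, hy⟩ := hZ
  obtain ⟨x, y⟩ := Z
  obtain rfl : y = g x := hy
  rw [hasDerivWithinAt_iff_isLittleO, Asymptotics.isLittleO_iff]
  intro c hc
  filter_upwards [(h c hc).graph (continuousOn_of_abs_le hα0 hl) hx] with s hs
  simpa [mul_comm] using hs

end MarkovSystem

/-! ### Dependence of the slope map on the base point -/

/-- A function with slopes locally bounded by all constants above `C` is `C`-Lipschitz. -/
theorem sub_le_of_local {f : ℝ → ℝ} {C : ℝ}
    (h : ∀ y ∈ Icc (0 : ℝ) 1, ∀ C' > C, ∀ᶠ s in nhdsWithin y (Icc 0 1),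
      |f s - f y| ≤ C' * |s - y|) (hc : ContinuousOn f (Icc 0 1)) {y y' : ℝ}
    (hy : y ∈ Icc (0 : ℝ) 1) (hy' : y' ∈ Icc (0 : ℝ) 1) (hle : y ≤ y') :
    f y' - f y ≤ C * (y' - y) := by
  have hsub : Icc y y' ⊆ Icc 0 1 := Icc_subset_Icc hy.1 hy'.2
  have := image_le_of_liminf_slope_right_le_deriv_boundary (f := f) (a := y) (b := y')
    (hc.mono hsub) (B := fun x => f y + C * (x - y)) (B' := fun _ => C) (by simp)
    (by fun_prop)
    (fun x _ => by
      simpa using ((((hasDerivAt_id x).sub_const y).const_mul C).const_add (f y)).hasDerivWithinAt)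
    (fun x hx r hr => by
      have hx1 : x ∈ Icc (0 : ℝ) 1 := hsub (Ico_subset_Icc_self hx)
      obtain ⟨C', hC', hr'⟩ := exists_between hr
      have hx1' : x < 1 := hx.2.trans_le hy'.2
      have hle : nhdsWithin x (Ioi x) ≤ nhdsWithin x (Icc 0 1) := by
        rw [← nhdsWithin_Ioc_eq_nhdsGT hx1']
        exact nhdsWithin_mono _ fun s hs => ⟨hx1.1.trans hs.1.le, hs.2⟩
      refine Filter.Eventually.frequently ?_
      filter_upwards [(h x hx1 C' hC').filter_mono hle, self_mem_nhdsWithin] with s hs hxs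
      have hpos : 0 < s - x := sub_pos.2 hxs
      rw [slope_def_field]
      refine lt_of_le_of_lt ?_ hr'
      rw [div_le_iff₀ hpos]
      rw [abs_of_pos hpos] at hs
      exact (le_abs_self _).trans hs)
    (right_mem_Icc.2 hle)
  linarith

theorem abs_sub_le_of_local {f : ℝ → ℝ} {C : ℝ}
    (h : ∀ y ∈ Icc (0 : ℝ) 1, ∀ C' > C, ∀ᶠ s in nhdsWithin y (Icc 0 1),
      |f s - f y| ≤ C' * |s - y|) (hc : ContinuousOn f (Icc 0 1)) {y y' : ℝ}
    (hy : y ∈ Icc (0 : ℝ) 1) (hy' : y' ∈ Icc (0 : ℝ) 1) :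
    |f y' - f y| ≤ C * |y' - y| := by
  wlog hle : y ≤ y' generalizing y y'
  · rw [abs_sub_comm, abs_sub_comm y']
    exact this hy' hy (le_of_not_ge hle)
  rw [abs_of_nonneg (sub_nonneg.2 hle), abs_le]
  have h1 := sub_le_of_local h hc hy hy' hle
  have h2 := sub_le_of_local (f := fun x => -f x) (C := C) (fun y hy C' hC' => by
    filter_upwards [h y hy C' hC'] with s hs
    rwa [← neg_sub', abs_neg]) hc.neg hy hy' hle
  constructor <;> linarith

/-- The derivative of the slope map with respect to the point. -/
theorem exists_hasFDerivAt_slopeMap {F : ℝ × ℝ → ℝ × ℝ} {z : ℝ × ℝ} (hF : ContDiffAt ℝ 2 F z)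
    {a : ℝ} (ha : |a| ≤ 1) (hD : (dx F z).1 + a * (dy F z).1 ≠ 0) (hφ : |slopeMap F z a| ≤ 1) :
    ∃ L : ℝ × ℝ →L[ℝ] ℝ, HasFDerivAt (fun w => slopeMap F w a) L z ∧
      ∀ v, |L v| ≤ 8 * secondDerivSize F z / |(dx F z).1 + a * (dy F z).1| * ‖v‖ := by
  have hdF : DifferentiableAt ℝ (fderiv ℝ F) z :=
    (hF.fderiv_right (m := 1) (by norm_num)).differentiableAt (by norm_num)
  have hX : DifferentiableAt ℝ (dx F) z := hdF.clm_apply (differentiableAt_const _)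
  have hY : DifferentiableAt ℝ (dy F) z := hdF.clm_apply (differentiableAt_const _)
  have happ : ∀ v w : ℝ × ℝ, fderiv ℝ (fun x => fderiv ℝ F x v) z w =
      fderiv ℝ (fderiv ℝ F) z w v := fun v w => by
    rw [fderiv_clm_apply hdF (differentiableAt_const v)]
    simp
  -- `secondDerivSize` contains only one of the two mixed derivatives.
  have hsymm : dy (dx F) z = dx (dy F) z := by
    have := hF.isSymmSndFDerivAt (by simp) (0, 1) (1, 0)
    rw [← happ, ← happ] at this
    exact this
  set M := secondDerivSize F z with hM
  have hM0 : 0 ≤ M := (norm_nonneg _).trans (le_max_left _ _)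
  have h1 : ‖dx (dx F) z‖ ≤ M := le_max_left _ _
  have h2 : ‖dx (dy F) z‖ ≤ M := (le_max_left _ _).trans (le_max_right _ _)
  have h3 : ‖dy (dy F) z‖ ≤ M := (le_max_right _ _).trans (le_max_right _ _)
  have bound : ∀ G : ℝ × ℝ → ℝ × ℝ, ‖dx G z‖ ≤ M → ‖dy G z‖ ≤ M → ∀ v : ℝ × ℝ,
      ‖fderiv ℝ G z v‖ ≤ 2 * M * ‖v‖ := by
    intro G g1 g2 v
    rw [fderiv_apply_eq]
    have n1 : ‖v.1‖ ≤ ‖v‖ := norm_fst_le v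
    have n2 : ‖v.2‖ ≤ ‖v‖ := norm_snd_le v
    calc _ ≤ ‖v.1‖ * ‖dx G z‖ + ‖v.2‖ * ‖dy G z‖ := by
          rw [← norm_smul, ← norm_smul]; exact norm_add_le _ _
      _ ≤ ‖v‖ * M + ‖v‖ * M := by gcongr
      _ = _ := by ring
  have bX := bound (dx F) h1 (by rwa [hsymm])
  have bY := bound (dy F) h2 h3
  set φ := slopeMap F z a with hφd
  set D : ℝ × ℝ → ℝ := fun w => (dx F w).1 + a * (dy F w).1 with hDd
  -- With `φ` frozen at its value at `z`, the slope map is `φ + ℓ (Fₓ + a Fᵧ) / D`. The numerator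
  -- vanishes at `z`, so the derivative of `1 / D` drops out. The `8` is a factor `2` each from `ℓ`,
  -- from `Fₓ + a Fᵧ`, and from the two partial derivatives.
  let ℓ : ℝ × ℝ →L[ℝ] ℝ := ContinuousLinearMap.snd ℝ ℝ ℝ - φ • ContinuousLinearMap.fst ℝ ℝ ℝ
  have hℓ : ∀ w, |ℓ w| ≤ 2 * ‖w‖ := fun w => by
    have n1 : |w.1| ≤ ‖w‖ := norm_fst_le w
    have n2 : |w.2| ≤ ‖w‖ := norm_snd_le w
    calc |w.2 - φ * w.1| ≤ |w.2| + |φ * w.1| := abs_sub _ _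
      _ = |w.2| + |φ| * |w.1| := by rw [abs_mul]
      _ ≤ ‖w‖ + 1 * ‖w‖ := by gcongr
      _ = _ := by ring
  set P : ℝ × ℝ → ℝ := fun w => ℓ (dx F w + a • dy F w) with hPd
  have hP : HasFDerivAt P (ℓ.comp (fderiv ℝ (dx F) z + a • fderiv ℝ (dy F) z)) z :=
    ℓ.hasFDerivAt.comp z (hX.hasFDerivAt.add (hY.hasFDerivAt.const_smul a))
  have hPz : P z = 0 := by
    have e : φ * ((dx F z).1 + a * (dy F z).1) = (dx F z).2 + a * (dy F z).2 :=
      div_mul_cancel₀ _ hD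
    change (dx F z).2 + a * (dy F z).2 - φ * ((dx F z).1 + a * (dy F z).1) = 0
    rw [e, sub_self]
  have hDdiff : DifferentiableAt ℝ D z := by
    have := (hX.add (hY.const_smul a)).fst
    exact this
  have hDinv : DifferentiableAt ℝ (fun w => (D w)⁻¹) z := hDdiff.inv hD
  have hprod := hP.mul hDinv.hasFDerivAt
  rw [hPz, zero_smul, zero_add] at hprod
  refine ⟨(D z)⁻¹ • ℓ.comp (fderiv ℝ (dx F) z + a • fderiv ℝ (dy F) z), ?_, fun v => ?_⟩
  · have hev : (fun w => slopeMap F w a) =ᶠ[nhds z] fun w => φ + P w * (D w)⁻¹ := by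
      filter_upwards [hDdiff.continuousAt.eventually_ne hD] with w hw
      have e : P w = (dx F w).2 + a * (dy F w).2 - φ * D w := rfl
      rw [e, slopeMap, sub_mul, mul_assoc, mul_inv_cancel₀ hw]
      change _ / D w = _
      rw [div_eq_mul_inv]; ring
    exact (hprod.const_add φ).congr_of_eventuallyEq hev
  · have e : ((D z)⁻¹ • ℓ.comp (fderiv ℝ (dx F) z + a • fderiv ℝ (dy F) z)) v =
        (D z)⁻¹ * ℓ (fderiv ℝ (dx F) z v + a • fderiv ℝ (dy F) z v) := rfl
    rw [e, abs_mul, abs_inv]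
    have n : ‖fderiv ℝ (dx F) z v + a • fderiv ℝ (dy F) z v‖ ≤ 4 * M * ‖v‖ := by
      calc _ ≤ ‖fderiv ℝ (dx F) z v‖ + |a| * ‖fderiv ℝ (dy F) z v‖ := by
            rw [← Real.norm_eq_abs, ← norm_smul]; exact norm_add_le _ _
        _ ≤ 2 * M * ‖v‖ + 1 * (2 * M * ‖v‖) := by gcongr; exacts [bX v, bY v]
        _ = _ := by ring
    calc |D z|⁻¹ * |ℓ (fderiv ℝ (dx F) z v + a • fderiv ℝ (dy F) z v)|
        ≤ |D z|⁻¹ * (2 * (4 * M * ‖v‖)) := by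
          gcongr; exact (hℓ _).trans (by gcongr)
      _ = _ := by rw [div_eq_mul_inv]; ring

namespace MarkovSystem

variable {ι : Type*} {M : MarkovSystem ι} {α K₀ C₀ : ℝ}

theorem Hyperbolic.norm_dx (hM : M.Hyperbolic α K₀) (hα0 : 0 < α) (hα1 : α < 1) {i : ι}
    {z : ℝ × ℝ} (hz : z ∈ M.E i) : ‖dx (M.f i) z‖ = |(dx (M.f i) z).1| := by
  refine max_eq_left ?_
  change |(dx (M.f i) z).2| ≤ |(dx (M.f i) z).1|
  have h1 := hM.h1 i z hz
  have : 0 ≤ α * |(dy (M.f i) z).2| + α ^ 2 * |(dy (M.f i) z).1| := by positivity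
  have := mul_le_mul_of_nonneg_right hα1.le (abs_nonneg (dx (M.f i) z).1)
  linarith

/-- Along stable manifolds the slope map depends on the point in a Lipschitz way. -/
theorem Hyperbolic.slopeMap_lipschitz (hM : M.Hyperbolic α K₀) (hD : M.Distortion C₀)
    (hα0 : 0 < α) (hα1 : α < 1) (hK₀ : 1 < K₀) {q : ℕ → ι} {z z' : ℝ × ℝ}
    (hz : z ∈ M.stable q) (hz' : z' ∈ M.stable q) {a : ℝ} (ha : |a| ≤ α) :
    |slopeMap (M.f (q 0)) z' a - slopeMap (M.f (q 0)) z a| ≤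
      8 * C₀ / (1 - α ^ 2) * |z'.2 - z.2| := by
  have hw := hM.width_pos
  obtain ⟨h, hl, e⟩ := hM.stable_graph hα0 hα1 hK₀ q
  have hE : ∀ y ∈ Icc (0 : ℝ) 1, (h y, y) ∈ M.E (q 0) := fun y hy => by
    have : (h y, y) ∈ M.stable q := by rw [e]; exact ⟨hy, rfl⟩
    exact (mem_iInter.1 this 1).1
  set C := 8 * C₀ / (1 - α ^ 2) with hC
  have hcurve : ∀ y ∈ Icc (0 : ℝ) 1, Filter.Tendsto (fun s => (h s, s))
      (nhdsWithin y (Icc 0 1)) (nhds (h y, y)) := fun y hy =>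
    ((continuousOn_of_abs_le hα0 hl y hy).prodMk continuousWithinAt_id).tendsto
  have hderiv : ∀ y ∈ Icc (0 : ℝ) 1, ∃ L : ℝ × ℝ →L[ℝ] ℝ,
      HasFDerivAt (fun w => slopeMap (M.f (q 0)) w a) L (h y, y) ∧ ∀ v, |L v| ≤ C * ‖v‖ := by
    intro y hy
    have hz := hE y hy
    obtain ⟨L, hL, hLv⟩ := exists_hasFDerivAt_slopeMap (M.contDiffAt hz) (ha.trans hα1.le)
      (hM.denom_ne_zero hα0 hK₀ hz ha) ((hM.abs_slopeMap_le hα0 hK₀ hz ha).trans hα1.le)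
    refine ⟨L, hL, fun v => (hLv v).trans (mul_le_mul_of_nonneg_right ?_ (norm_nonneg v))⟩
    have h1 := hM.denom_ge hα0 hz ha
    have h2 := hM.expansion_ge hα0 hz
    have h3 := hD (q 0) _ hz
    rw [hM.norm_dx hα0 hα1 hz] at h3
    have h4 := hM.h2 _ _ hz
    have hp : 0 < |(dx (M.f (q 0)) (h y, y)).1| := by
      have : 0 ≤ α * |(dy (M.f (q 0)) (h y, y)).1| := by positivity
      linarith
    rw [div_le_iff₀ hp] at h3
    have hC₀ : 0 ≤ C₀ := by
      have : 0 ≤ secondDerivSize (M.f (q 0)) (h y, y) := (norm_nonneg _).trans (le_max_left _ _)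
      exact nonneg_of_mul_nonneg_left (this.trans h3) hp
    rw [div_le_iff₀ (by linarith)]
    calc _ ≤ 8 * (C₀ * |(dx (M.f (q 0)) (h y, y)).1|) := by gcongr
      _ = C * ((1 - α ^ 2) * |(dx (M.f (q 0)) (h y, y)).1|) := by
        rw [hC]; field_simp
      _ ≤ _ := by gcongr; linarith
  -- The curve `h` is only known to be Lipschitz, so the chain rule is replaced by local bounds with
  -- every constant above `C`.
  have hlocal : ∀ y ∈ Icc (0 : ℝ) 1, ∀ C' > C, ∀ᶠ s in nhdsWithin y (Icc 0 1),
      |slopeMap (M.f (q 0)) (h s, s) a - slopeMap (M.f (q 0)) (h y, y) a| ≤ C' * |s - y| := by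
    intro y hy C' hC'
    obtain ⟨L, hL, hLv⟩ := hderiv y hy
    have hlin := (hcurve y hy).eventually (hL.isLittleO.def (sub_pos.2 hC'))
    filter_upwards [hlin, self_mem_nhdsWithin] with s hs hsI
    set v : ℝ × ℝ := (h s, s) - (h y, y) with hv
    have hn : ‖v‖ ≤ |s - y| := by
      refine max_le ?_ le_rfl
      change |h s - h y| ≤ _
      have := mul_le_mul_of_nonneg_right hα1.le (abs_nonneg (s - y))
      linarith [hl y hy s hsI]
    have hC'0 : 0 ≤ C' := by
      have h0 := (abs_nonneg _).trans (hLv (0, 1))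
      have : ‖((0, 1) : ℝ × ℝ)‖ = 1 := by simp [Prod.norm_def]
      rw [this, mul_one] at h0
      linarith
    rw [Real.norm_eq_abs] at hs
    set A := slopeMap (M.f (q 0)) (h s, s) a - slopeMap (M.f (q 0)) (h y, y) a
    calc |A| = |L v + (A - L v)| := by ring_nf
      _ ≤ C * ‖v‖ + (C' - C) * ‖v‖ := (abs_add_le _ _).trans (add_le_add (hLv v) hs)
      _ = C' * ‖v‖ := by ring
      _ ≤ _ := by gcongr
  have hcont : ContinuousOn (fun s => slopeMap (M.f (q 0)) (h s, s) a) (Icc 0 1) := fun y hy => by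
    obtain ⟨L, hL, -⟩ := hderiv y hy
    exact hL.continuousAt.tendsto.comp (hcurve y hy)
  rw [e] at hz hz'
  have hzz : z = (h z.2, z.2) := Prod.ext hz.2 rfl
  have hzz' : z' = (h z'.2, z'.2) := Prod.ext hz'.2 rfl
  have := abs_sub_le_of_local hlocal hcont hz.1 hz'.1
  rwa [← hzz, ← hzz'] at this

/-! ### Comparison of slopes along a common past -/

/-- Unstable manifolds with a long common past are exponentially close, together with their
slopes, along a stable manifold. -/
theorem Hyperbolic.slopes_close (hM : M.Hyperbolic α K₀) (hD : M.Distortion C₀)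
    (hα0 : 0 < α) (hα1 : α < 1) (hK₀ : 1 < K₀) {θ c : ℝ}
    (hθ : 1 / (K₀ ^ 2 * (1 - α ^ 2)) < θ) (hθK : K₀⁻¹ ≤ θ) (hc2 : 2 ≤ c)
    (hc : 8 * C₀ / (1 - α ^ 2) ≤ c * (θ - 1 / (K₀ ^ 2 * (1 - α ^ 2)))) (m : ℕ)
    {p p' q : ℕ → ι} (hpp : ∀ k < m, p k = p' k) {Z Z' : ℝ × ℝ}
    (hZ : Z ∈ M.unstable p) (hZ' : Z' ∈ M.unstable p') (hq : Z ∈ M.stable q)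
    (hq' : Z' ∈ M.stable q) {a a' : ℝ} (ha : ∀ δ > 0, ApproxSlope (M.unstable p) Z a δ)
    (ha' : ∀ δ > 0, ApproxSlope (M.unstable p') Z' a' δ) (hab : |a| ≤ α) (hab' : |a'| ≤ α) :
    |Z'.2 - Z.2| ≤ θ ^ m ∧ |a' - a| ≤ c * θ ^ m := by
  have hw := hM.width_pos
  have hK0 : 0 < K₀ := by linarith
  have hθ0 : 0 < θ := lt_of_lt_of_le (by positivity) hθK
  induction m generalizing p p' q Z Z' a a' with
  | zero =>
    have h1 := (cylinder_subset_Q _ _ (mem_iInter.1 hq 0)).2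
    have h2 := (cylinder_subset_Q _ _ (mem_iInter.1 hq' 0)).2
    rw [pow_zero, mul_one]
    constructor
    · rw [abs_le]; constructor <;> linarith [h1.1, h1.2, h2.1, h2.2]
    · have := abs_sub a' a
      linarith
  | succ m ih =>
    obtain ⟨z, hE, hz, rfl⟩ := exists_preimage_unstable hZ
    obtain ⟨z', hE', hz', rfl⟩ := exists_preimage_unstable hZ'
    obtain ⟨b, hb, hbs⟩ := hM.exists_slope hα0 hα1 hK₀ _ hz
    obtain ⟨b', hb', hbs'⟩ := hM.exists_slope hα0 hα1 hK₀ _ hz'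
    -- Approximate slopes of arbitrarily small radius are unique, so the slope at an image point is
    -- the image of the slope.
    have unique : ∀ {p : ℕ → ι} {z : ℝ × ℝ} {a b : ℝ}, z ∈ M.E (p 0) →
        (z ∈ M.unstable fun k => p (k + 1)) → M.f (p 0) z ∈ M.unstable p → |b| ≤ α →
        (∀ δ > 0, ApproxSlope (M.unstable p) (M.f (p 0) z) a δ) →
        (∀ δ > 0, ApproxSlope (M.unstable fun k => p (k + 1)) z b δ) →
        a = slopeMap (M.f (p 0)) z b := by
      intro p z a b hE hz hZ hb ha hbs
      refine sub_eq_zero.1 (abs_nonpos_iff.1 (le_of_forall_pos_le_add fun ε hε => ?_))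
      have h1 := hM.approxSlope_map hα0 hα1 hK₀ hθ (δ := ε / 2 / θ) (by positivity) hb hE hz
        (hbs _ (by positivity))
      have := hM.approxSlope_sub_le hα0 hα1 hK₀ hZ (ha (ε / 2) (by positivity)) h1
      rw [mul_div_cancel₀ _ hθ0.ne'] at this
      linarith
    have e := unique hE hz hZ hb ha hbs
    have e' := unique hE' hz' hZ' hb' ha' hbs'
    rw [← hpp 0 (by omega)] at e' hE' hq' ⊢
    -- The future `q` with `p 0` put in front: the preimages lie on its stable manifold.
    set r : ℕ → ι := fun k => Nat.casesOn k (p 0) q with hr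
    have hzr : z ∈ M.stable r := mem_stable_of_map (q := r) hE hq
    have hzr' : z' ∈ M.stable r := mem_stable_of_map (q := r) hE' hq'
    obtain ⟨i1, i2⟩ := ih (fun k hk => hpp (k + 1) (by omega)) hz hz' hzr hzr' hbs hbs' hb hb'
    have hv := (hM.vertical_pair hα0 hα1 hK₀ hE hE' (hM.stable_pair hα0 hα1 hK₀ hq hq')).2
    constructor
    · rw [mul_comm, ← le_div_iff₀ hK0, div_eq_mul_inv] at hv
      calc _ ≤ |z'.2 - z.2| * K₀⁻¹ := hv
        _ ≤ θ ^ m * θ := by gcongr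
        _ = _ := (pow_succ _ _).symm
    · have h1 := hM.slopeMap_contract hα0 hK₀ hE' hb' hb
      have h2 : |slopeMap (M.f (p 0)) z' b - slopeMap (M.f (p 0)) z b| ≤ _ :=
        hM.slopeMap_lipschitz hD hα0 hα1 hK₀ hzr hzr' hb
      have h3 : 8 * C₀ / (1 - α ^ 2) * |z'.2 - z.2| ≤
          c * (θ - 1 / (K₀ ^ 2 * (1 - α ^ 2))) * θ ^ m :=
        mul_le_mul hc i1 (abs_nonneg _) (mul_nonneg (by linarith) (by linarith))
      rw [e, e']
      -- First change the slope at `z'`, then the base point with the slope fixed; the two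
      -- contributions add up to exactly `c * θ ^ (m + 1)`.
      calc _ ≤ |slopeMap (M.f (p 0)) z' b' - slopeMap (M.f (p 0)) z' b| +
            |slopeMap (M.f (p 0)) z' b - slopeMap (M.f (p 0)) z b| := abs_sub_le _ _ _
        _ ≤ 1 / (K₀ ^ 2 * (1 - α ^ 2)) * (c * θ ^ m) +
            c * (θ - 1 / (K₀ ^ 2 * (1 - α ^ 2))) * θ ^ m := by
          refine add_le_add (h1.trans ?_) (h2.trans h3)
          gcongr
        _ = _ := by ring

end MarkovSystem

end CountableMarkov

end

theorem lemma5p2 (α K₀ C₀ : ℝ) (hα0 : 0 < α) (hα1 : α < 1) (hK₀ : 1 < K₀) (hC₀ : 0 < C₀) :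
    ∃ c₀ θ₀ : ℝ, 0 < c₀ ∧ 0 < θ₀ ∧ θ₀ < 1 ∧
      ∀ (ι : Type*) [Countable ι] (M : CountableMarkov.MarkovSystem ι),
        M.Geometric → M.Hyperbolic α K₀ → M.Distortion C₀ →
        -- the rectangle, with `m` negative symbols taken from `w` and `n` others from `q`
        ∀ (m n : ℕ) (w q : ℕ → ι), 1 ≤ n →
        -- two unstable manifolds through it: their pasts end with the same `m` symbols
        ∀ p₃ p₄ : ℕ → ι, (∀ k < m, p₃ k = w k) → (∀ k < m, p₄ k = w k) →
        -- their intersection points with one stable manifold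
        ∀ Z₃ ∈ M.rect w q m n, ∀ Z₄ ∈ M.rect w q m n,
          Z₃ ∈ M.unstable p₃ ∩ M.stable q → Z₄ ∈ M.unstable p₄ ∩ M.stable q →
          ∃ a₃ a₄ : ℝ, CountableMarkov.IsSlope (M.unstable p₃) Z₃ a₃ ∧
            CountableMarkov.IsSlope (M.unstable p₄) Z₄ a₄ ∧ |a₃ - a₄| < c₀ * θ₀ ^ m := by
  -- The constants precede the system, while `h5` is part of `Hyperbolic`. If it fails, no system
  -- qualifies and any constants do.
  by_cases h5 : 1 / K₀ ^ 2 + α ^ 2 < 1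
  swap
  · exact ⟨1, 1 / 2, by norm_num, by norm_num, by norm_num, fun ι _ M _ hM => absurd hM.h5 h5⟩
  have hw : 0 < 1 - α ^ 2 := by
    have : 0 ≤ 1 / K₀ ^ 2 := by positivity
    linarith
  have hrate : 1 / (K₀ ^ 2 * (1 - α ^ 2)) < 1 := by
    rw [div_lt_one (by positivity)]
    have : 1 / K₀ ^ 2 < 1 - α ^ 2 := by linarith
    rwa [div_lt_iff₀ (by positivity), mul_comm] at this
  obtain ⟨θ, hθ, hθ1⟩ := exists_between (max_lt hrate (inv_lt_one_of_one_lt₀ hK₀))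
  obtain ⟨hθr, hθK⟩ := max_lt_iff.1 hθ
  have hθ0 : 0 < θ := lt_trans (by positivity) hθr
  set κ := 1 / (K₀ ^ 2 * (1 - α ^ 2)) with hκ
  -- The `2` covers the case `m = 0`, where slopes lie in `[-α, α]`; the other term pays for the
  -- change of base point.
  set c := 2 + 8 * C₀ / (1 - α ^ 2) / (θ - κ) with hc
  have hgap : 0 < θ - κ := sub_pos.2 hθr
  have hcC : 8 * C₀ / (1 - α ^ 2) ≤ c * (θ - κ) := by
    rw [hc, add_mul, div_mul_cancel₀ _ hgap.ne']
    linarith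
  have hc2 : 2 ≤ c := by
    have : 0 ≤ 8 * C₀ / (1 - α ^ 2) / (θ - κ) := by positivity
    linarith
  -- The extra `1` makes the inequality strict.
  refine ⟨c + 1, θ, by linarith, hθ0, hθ1, ?_⟩
  intro ι _ M _ hM hD m n w q _ p₃ p₄ h₃ h₄ Z₃ _ Z₄ _ hZ₃ hZ₄
  obtain ⟨a₃, hb₃, ha₃⟩ := hM.exists_slope hα0 hα1 hK₀ p₃ hZ₃.1
  obtain ⟨a₄, hb₄, ha₄⟩ := hM.exists_slope hα0 hα1 hK₀ p₄ hZ₄.1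
  refine ⟨a₃, a₄, hM.isSlope_of_approxSlope hα0 hα1 hK₀ hZ₃.1 ha₃,
    hM.isSlope_of_approxSlope hα0 hα1 hK₀ hZ₄.1 ha₄, ?_⟩
  have := (hM.slopes_close hD hα0 hα1 hK₀ hθr hθK.le hc2 hcC m
    (fun k hk => (h₄ k hk).trans (h₃ k hk).symm) hZ₄.1 hZ₃.1 hZ₄.2 hZ₃.2 ha₄ ha₃ hb₄ hb₃).2
  have hpos : 0 < θ ^ m := by positivity
  linarith
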